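/- **Theorem.** There are a word-RAM program $P$, an integer $c\ge 1$, a constant $C$ and constants $K_\gamma$ ($\gamma>0$), all independent of $\varepsilon,n,u$, such that the following holds for every real $\varepsilon>0$ and all integers $n\ge 0$ and $u\ge 3$. There is a randomized mechanism $M$ that maps every multiset $S$ of at most $n$ elements of $\{1,\dots,u\}$ to a random data structure $M(S)$, a finite sequence of words of $w=c\lceil\log_2(u+n)\rceil$ bits each, and that is $\varepsilon$-differentially private: for all multisets $S,T$ of at most $n$ elements of $\{1,\dots,u\}$ such that $T$ arises from $S$ by adding, removing or replacing one element, and for every set $A$ of data structures, $$\Pr[M(S)\in A]\le e^{\varepsilon}\,\Pr[M(T)\in A].$$ For $i\in\{1,\dots,u\}$ let $\hat x_i$ be the answer of $P$ to the query $i$ when it is run, on a word RAM with $w$-bit words, with $M(S)$ in memory, and let $x_i$ be the multiplicity of $i$ in $S$. Then, for every multiset $S$ of at most $n$ elements of $\{1,\dots,u\}$: - *Space.* $M(S)$ always consists of at most $C\,n\log u$ bits. - *Access time.* For every $i$, the expected number of steps that $P$ takes on the query $i$ is at most $C\log\log u$. - *Expected error.* For every $i$, $\mathbb E\,|\hat x_i-x_i|\le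 C/\varepsilon$. - *Error with high probability.* For every $\gamma>0$, with probability at least $1-u^{-\gamma}$ we have $|\hat x_i-x_i|\le K_\gamma\log(u)/\varepsilon$ for all $i\in\{1,\dots,u\}$ simultaneously. All expectations and probabilities are over the randomness of $M$; $\log$ is the natural logarithm. -/

import Mathlib

open scoped ENNReal

/-! ### A word RAM with `w`-bit words -/

namespace WordRAM

/-- Binary word operations. -/
inductive Op
  | add | sub | mul | div | mod | bitAnd | bitOr | bitXor | shiftLeft | shiftRight | eq | lt

/-- Semantics of the operations on `w`-bit words, read as numbers in `{0, …, 2^w - 1}`: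
arithmetic is modulo `2^w`, and comparisons return `1` for true and `0` for false. -/
def Op.eval {w : ℕ} : Op → BitVec w → BitVec w → BitVec w
  | .add, a, b => a + b
  | .sub, a, b => a - b
  | .mul, a, b => a * b
  | .div, a, b => a / b
  | .mod, a, b => a % b
  | .bitAnd, a, b => a &&& b
  | .bitOr, a, b => a ||| b
  | .bitXor, a, b => a ^^^ b
  | .shiftLeft, a, b => a <<< b.toNat
  | .shiftRight, a, b => a >>> b.toNat
  | .eq, a, b => if a = b then 1#w else 0#w
  | .lt, a, b => if a.toNat < b.toNat then 1#w else 0#w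

/-- Instructions; `dst`, `src`, `addr`, `a`, `b`, `r` are register numbers. -/
inductive Instr
  /-- put the constant `k` (modulo `2^w`) into register `dst` -/
  | const (dst k : ℕ)
  /-- put the result of an operation on registers `a` and `b` into register `dst` -/
  | op (o : Op) (dst a b : ℕ)
  /-- put the memory word whose address is in register `addr` into register `dst` -/
  | load (dst addr : ℕ)
  /-- write register `src` to the memory word whose address is in register `addr` -/
  | store (addr src : ℕ)
  /-- continue at instruction number `target` -/
  | jump (target : ℕ)
  /-- continue at instruction number `target` if register `r` is zero -/
  | jumpIfZero (r target : ℕ)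
  /-- stop -/
  | halt

/-- A program is a finite list of instructions. It does not depend on the word size. -/
abbrev Program := List Instr

/-- A configuration of the machine: program counter, registers, memory. -/
structure State (w : ℕ) where
  pc : ℕ
  reg : ℕ → BitVec w
  mem : BitVec w → BitVec w

/-- Execution of one instruction; `none` if the instruction is `halt`. -/
def Instr.exec {w : ℕ} (s : State w) : Instr → Option (State w)
  | .const dst k => some ⟨s.pc + 1, Function.update s.reg dst (BitVec.ofNat w k), s.mem⟩
  | .op o dst a b =>
      some ⟨s.pc + 1, Function.update s.reg dst (o.eval (s.reg a) (s.reg b)), s.mem⟩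
  | .load dst addr => some ⟨s.pc + 1, Function.update s.reg dst (s.mem (s.reg addr)), s.mem⟩
  | .store addr src => some ⟨s.pc + 1, s.reg, Function.update s.mem (s.reg addr) (s.reg src)⟩
  | .jump target => some ⟨target, s.reg, s.mem⟩
  | .jumpIfZero r target => some ⟨if s.reg r = 0#w then target else s.pc + 1, s.reg, s.mem⟩
  | .halt => none

/-- One step of the program `P`; `none` if `P` has stopped in `s`, that is, if the current
instruction is `halt` or there is no current instruction. -/
def step {w : ℕ} (P : Program) (s : State w) : Option (State w) :=
  (P[s.pc]?).bind (Instr.exec s)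

/-- The initial configuration for the query `i` to the data structure `D`: the words of `D` occupy
the memory cells `0, 1, …`, register `0` holds `i`, everything else is zero. -/
def init {w : ℕ} (D : List (BitVec w)) (i : ℕ) : State w where
  pc := 0
  reg := Function.update (fun _ => 0#w) 0 (BitVec.ofNat w i)
  mem := fun a => D.getD a.toNat 0#w

/-- The configuration after `t` steps (a stopped machine does not move any more). -/
def stateAfter {w : ℕ} (P : Program) (D : List (BitVec w)) (i t : ℕ) : State w :=
  (fun s => (step P s).getD s)^[t] (init D i)

/-- The access time: the number of steps until `P` stops on the query `i` to the data structure
`D`, which is `⊤` if `P` never stops. -/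
noncomputable def accessTime {w : ℕ} (P : Program) (D : List (BitVec w)) (i : ℕ) : ℕ∞ :=
  ⨅ (t : ℕ) (_ : step P (stateAfter P D i t) = none), (t : ℕ∞)

/-- The answer to the query: the content of register `0` when `P` stops. -/
noncomputable def answer {w : ℕ} (P : Program) (D : List (BitVec w)) (i : ℕ) : ℕ :=
  ((stateAfter P D i (accessTime P D i).toNat).reg 0).toNat

end WordRAM

/-! ### Privacy and expectations -/

/-- Two multisets are neighbours if one arises from the other by adding one element, by removing
one element, or by replacing one element (or if they are equal). -/
def Neighbouring {α : Type*} [DecidableEq α] (S T : Multiset α) : Prop :=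
  (S - T).card ≤ 1 ∧ (T - S).card ≤ 1

/-- `ε`-differential privacy of a randomized mechanism `M` on the multisets of at most `n`
elements of `α`. -/
def DifferentiallyPrivate {α β : Type*} [DecidableEq α] (n : ℕ) (ε : ℝ)
    (M : Multiset α → PMF β) : Prop :=
  ∀ S T : Multiset α, S.card ≤ n → T.card ≤ n → Neighbouring S T →
    ∀ A : Set β, (M S).toOuterMeasure A ≤ ENNReal.ofReal (Real.exp ε) * (M T).toOuterMeasure A

/-- The expectation of `f` under `p`. -/
noncomputable def PMF.expectation {β : Type*} (p : PMF β) (f : β → ℝ≥0∞) : ℝ≥0∞ :=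
  ∑' b, p b * f b

/-- The word length, `c ⌈log₂ (u + n)⌉` bits. -/
def wordLength (c n u : ℕ) : ℕ := c * Nat.clog 2 (u + n)

/-- The error of the estimate of the multiplicity of `i` in `S` that the query program `P`
computes from the data structure `D`. -/
noncomputable def estimationError {w u : ℕ} (P : WordRAM.Program) (S : Multiset (Fin u))
    (D : List (BitVec w)) (i : Fin u) : ℝ :=
  |(WordRAM.answer P D i : ℝ) - (S.count i : ℝ)|

namespace WordRAM

/-- The query program: look the query up in a two-level hash table and, if it is absent, read the
packed bucket that it is hashed to. -/
def lookupProgram : Program :=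
  [.load 1 30, .const 10 8, .load 2 10, .const 11 16, .load 3 11,
   .op .mul 2 2 0, .op .mod 2 2 1, .op .mod 2 2 3, .op .mul 2 2 10, .const 12 1,
   .op .add 2 2 12, .load 3 2, .op .add 2 2 12, .load 4 2, .op .add 2 2 12, .load 5 2,
   .op .mul 3 3 0, .op .mod 3 3 1, .op .mod 3 3 4, .op .add 3 3 5, .op .mul 3 3 10,
   .const 13 4, .op .add 3 3 13, .load 4 3, .op .add 3 3 12, .load 5 3,
   .op .eq 4 4 0, .jumpIfZero 4 30, .op .bitOr 0 5 5, .halt,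
   .const 11 24, .load 2 11, .const 11 32, .load 3 11, .const 11 40, .load 4 11,
   .const 11 48, .load 5 11, .const 11 56, .load 6 11,
   .op .mul 2 2 0, .op .mod 2 2 1, .op .mod 2 2 3, .op .div 3 2 4, .op .mod 2 2 4,
   .op .mul 2 2 5, .op .mul 3 3 10, .const 11 6, .op .add 3 3 11, .load 3 3,
   .op .shiftRight 3 3 2, .op .mod 0 3 6, .halt]

variable {w : ℕ}

/-- `m` with the header array read at `j`. -/
def header (m : BitVec w → BitVec w) (j : ℕ) : BitVec w := m (BitVec.ofNat w (8 * j))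

/-- The hash function with multiplier `a` and range `s`. -/
def hashWord (m : BitVec w → BitVec w) (a s x : BitVec w) : BitVec w :=
  a * x % header m 0 % s

/-- Eight times the first-level hash value. -/
def topAddr (m : BitVec w → BitVec w) (x : BitVec w) : BitVec w :=
  hashWord m (header m 1) (header m 2) x * 8#w

/-- The address of the key in the cell of the second-level table. -/
def cellAddr (m : BitVec w → BitVec w) (x : BitVec w) : BitVec w :=
  (hashWord m (m (topAddr m x + 1#w)) (m (topAddr m x + 1#w + 1#w)) x +
    m (topAddr m x + 1#w + 1#w + 1#w)) * 8#w + 4#w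

/-- The index of the bucket of the query. -/
def bucketWord (m : BitVec w → BitVec w) (x : BitVec w) : BitVec w :=
  hashWord m (header m 3) (header m 4) x

/-- The content of the bucket of the query. -/
def bucketValue (m : BitVec w → BitVec w) (x : BitVec w) : BitVec w :=
  (m (bucketWord m x / header m 5 * 8#w + 6#w) >>>
    (bucketWord m x % header m 5 * header m 6).toNat) % header m 7

/-- The value that `lookupProgram` computes. -/
def lookupValue (m : BitVec w → BitVec w) (x : BitVec w) : BitVec w :=
  if m (cellAddr m x) = x then m (cellAddr m x + 1#w) else bucketValue m x

/-- The configuration after one step; a stopped machine does not move. -/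
def next (P : Program) (s : State w) : State w := (step P s).getD s

theorem iterate_next_of {P : Program} {k t : ℕ} {R : ℕ → BitVec w} {m : BitVec w → BitVec w}
    {ins : Instr} {s s' : State w} (h : P[k]? = some ins) (he : ins.exec ⟨k, R, m⟩ = some s')
    (h' : (next P)^[t] s' = s) : (next P)^[t + 1] ⟨k, R, m⟩ = s := by
  rw [Function.iterate_succ_apply, ← h']
  simp [next, step, h, he]

theorem next_iterate_top (R : ℕ → BitVec w) (m : BitVec w → BitVec w) (x : BitVec w)
    (h0 : R 0 = x) (h30 : R 30 = 0#w) : ∃ R',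
    (next lookupProgram)^[9] ⟨0, R, m⟩ = ⟨9, R', m⟩ ∧ R' 0 = x ∧ R' 1 = header m 0 ∧
      R' 2 = topAddr m x ∧ R' 10 = 8#w := by
  refine ⟨?_, ?_, ?_⟩
  rotate_left
  · iterate 9 refine iterate_next_of rfl rfl ?_
    exact rfl
  · simp [Function.update, Op.eval, h0, h30, topAddr, hashWord, header]

theorem next_iterate_cell (R : ℕ → BitVec w) (m : BitVec w → BitVec w) (x : BitVec w)
    (h0 : R 0 = x) (h1 : R 1 = header m 0) (h2 : R 2 = topAddr m x) (h10 : R 10 = 8#w) : ∃ R',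
    (next lookupProgram)^[18] ⟨9, R, m⟩ = ⟨27, R', m⟩ ∧ R' 0 = x ∧ R' 1 = header m 0 ∧
      R' 4 = (if m (cellAddr m x) = x then 1#w else 0#w) ∧ R' 5 = m (cellAddr m x + 1#w) ∧
      R' 10 = 8#w := by
  refine ⟨?_, ?_, ?_⟩
  rotate_left
  · iterate 18 refine iterate_next_of rfl rfl ?_
    exact rfl
  · simp [Function.update, Op.eval, h0, h1, h2, h10, cellAddr, hashWord]
    congr

theorem next_iterate_bucket (R : ℕ → BitVec w) (m : BitVec w → BitVec w) (x : BitVec w)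
    (h0 : R 0 = x) (h1 : R 1 = header m 0) (h10 : R 10 = 8#w) : ∃ R',
    (next lookupProgram)^[22] ⟨30, R, m⟩ = ⟨52, R', m⟩ ∧ R' 0 = bucketValue m x := by
  refine ⟨?_, ?_, ?_⟩
  rotate_left
  · iterate 22 refine iterate_next_of rfl rfl ?_
    exact rfl
  · simp [Function.update, Op.eval, h0, h1, h10, bucketValue, bucketWord, hashWord, header]

theorem stateAfter_eq (P : Program) (D : List (BitVec w)) (i t : ℕ) :
    stateAfter P D i t = (next P)^[t] (init D i) := rfl

/-- If `P` is stopped after `t` steps, then it answers what register `0` contains. -/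
theorem accessTime_le_and_answer_eq {P : Program} {D : List (BitVec w)} {i t : ℕ}
    (h : step P (stateAfter P D i t) = none) :
    accessTime P D i ≤ t ∧ answer P D i = ((stateAfter P D i t).reg 0).toNat := by
  classical
  have hex : ∃ t, step P (stateAfter P D i t) = none := ⟨t, h⟩
  have hle : Nat.find hex ≤ t := Nat.find_min' hex h
  have hA : accessTime P D i = (Nat.find hex : ℕ) :=
    le_antisymm (iInf₂_le (f := fun (t : ℕ) (_ : step P (stateAfter P D i t) = none) => (t : ℕ∞))
      (Nat.find hex) (Nat.find_spec hex))
      (le_iInf₂ fun r hr => by exact_mod_cast Nat.find_min' hex hr)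
  have hfix : ∀ r, stateAfter P D i (r + Nat.find hex) = stateAfter P D i (Nat.find hex) := by
    intro r
    induction r with
    | zero => simp
    | succ r ih =>
      rw [show r + 1 + Nat.find hex = (r + Nat.find hex) + 1 by ring, stateAfter_eq,
        Function.iterate_succ_apply', ← stateAfter_eq, ih, next, Nat.find_spec hex]
      rfl
  refine ⟨by rw [hA]; exact_mod_cast hle, ?_⟩
  rw [answer, hA, ENat.toNat_natCast, ← hfix (t - Nat.find hex), Nat.sub_add_cancel hle]

/-- The query program stops after at most `52` steps with the answer `lookupValue`. -/
theorem lookupProgram_spec (hw : w ≠ 0) (D : List (BitVec w)) (i : ℕ) :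
    accessTime lookupProgram D i ≤ 52 ∧ answer lookupProgram D i =
      (lookupValue (fun a => D.getD a.toNat 0#w) (BitVec.ofNat w i)).toNat := by
  set m : BitVec w → BitVec w := fun a => D.getD a.toNat 0#w with hm
  set x := BitVec.ofNat w i with hx
  obtain ⟨Q, e₁, a0, a1, a2, a10⟩ := next_iterate_top
    (Function.update (fun _ => 0#w) 0 x) m x rfl rfl
  obtain ⟨R, e₂, r0, r1, r4, r5, r10⟩ := next_iterate_cell Q m x a0 a1 a2 a10
  have e' : (next lookupProgram)^[27] (init D i) = ⟨27, R, m⟩ := by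
    rw [show 27 = 18 + 9 from rfl, Function.iterate_add_apply, ← e₂, ← e₁]
    rfl
  by_cases h : m (cellAddr m x) = x
  · rw [if_pos h] at r4
    have h4 : R 4 ≠ 0#w := by
      rw [r4]
      intro h
      have := congrArg BitVec.toNat h
      simp [Nat.one_mod_two_pow (Nat.pos_of_ne_zero hw)] at this
    have e3 : stateAfter lookupProgram D i 29 = ⟨29, Function.update R 0 (R 5 ||| R 5), m⟩ := by
      rw [stateAfter_eq, show 29 = 2 + 27 from rfl, Function.iterate_add_apply, e']
      refine iterate_next_of rfl (s' := ⟨28, R, m⟩) ?_ ?_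
      · simp [Instr.exec, h4]
      · exact iterate_next_of rfl rfl rfl
    obtain ⟨q1, q2⟩ := accessTime_le_and_answer_eq (P := lookupProgram) (D := D) (i := i) (t := 29)
      (by rw [e3]; rfl)
    refine ⟨q1.trans (by norm_num), ?_⟩
    rw [q2, e3, lookupValue, if_pos h, ← r5]
    simp
  · rw [if_neg h] at r4
    obtain ⟨R', e2, s0⟩ := next_iterate_bucket R m x r0 r1 r10
    have e3 : stateAfter lookupProgram D i 50 = ⟨52, R', m⟩ := by
      rw [stateAfter_eq, show 50 = 23 + 27 from rfl, Function.iterate_add_apply, e', ← e2]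
      refine iterate_next_of rfl (s' := ⟨30, R, m⟩) ?_ rfl
      simp [Instr.exec, r4]
    obtain ⟨q1, q2⟩ := accessTime_le_and_answer_eq (P := lookupProgram) (D := D) (i := i) (t := 50)
      (by rw [e3]; rfl)
    refine ⟨q1.trans (by norm_num), ?_⟩
    rw [q2, e3, lookupValue, if_neg h, ← s0]

/-- The empty data structure answers `0` to every query. -/
theorem answer_lookupProgram_nil (hw : w ≠ 0) (i : ℕ) :
    answer lookupProgram ([] : List (BitVec w)) i = 0 := by
  rw [(lookupProgram_spec hw _ _).2, lookupValue]
  split_ifs <;> simp [bucketValue, header]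

end WordRAM

/-! ### Hashing -/

/-- The hash function with multiplier `a`, prime modulus `p` and range `{0, …, s - 1}`. -/
def hashNat (p a s i : ℕ) : ℕ := a * i % p % s

theorem card_collision_mul_le {p s i j : ℕ} (hp : p.Prime) (hi : i < p) (hj : j < p)
    (hij : i ≠ j) :
    ((Finset.Icc 1 (p - 1)).filter fun a => hashNat p a s i = hashNat p a s j).card * s ≤
      2 * (p - 1) := by
  rcases Nat.eq_zero_or_pos s with rfl | hs
  · simp
  have hp0 : 0 < p := hp.pos
  set r : ℕ := (p - 1) / s with hr
  have hmaps : ∀ a ∈ (Finset.Icc 1 (p - 1)).filter fun a => hashNat p a s i = hashNat p a s j,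
      (((a * i % p : ℕ) : ℤ) - ((a * j % p : ℕ) : ℤ)) / s ∈ (Finset.Icc (-r : ℤ) r).erase 0 := by
    intro a ha
    obtain ⟨ha1, ha2⟩ := Finset.mem_filter.1 ha
    rw [Finset.mem_Icc] at ha1
    have hmod : (a * i % p) % s = (a * j % p) % s := ha2
    have hdvd : (s : ℤ) ∣ ((a * i % p : ℕ) : ℤ) - ((a * j % p : ℕ) : ℤ) :=
      (Nat.modEq_iff_dvd.1 hmod.symm)
    obtain ⟨t, ht⟩ := hdvd
    have hs' : (0 : ℤ) < s := by exact_mod_cast hs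
    rw [ht, Int.mul_ediv_cancel_left _ hs'.ne']
    have hx : a * i % p < p := Nat.mod_lt _ hp0
    have hy : a * j % p < p := Nat.mod_lt _ hp0
    zify at hx hy
    have hx0 := Int.natCast_nonneg (a * i % p)
    have hy0 := Int.natCast_nonneg (a * j % p)
    push_cast at hx hy hx0 hy0 ht
    rw [Finset.mem_erase, Finset.mem_Icc]
    refine ⟨?_, ?_, ?_⟩
    · rintro rfl
      have heq : a * i % p = a * j % p := by
        have : ((a * i % p : ℕ) : ℤ) = ((a * j % p : ℕ) : ℤ) := by push_cast; linarith
        exact_mod_cast this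
      have hcop : Nat.gcd p a = 1 :=
        hp.coprime_iff_not_dvd.2 (Nat.not_dvd_of_pos_of_lt (by omega) (by omega))
      have h2 : i ≡ j [MOD p] := Nat.ModEq.cancel_left_of_coprime hcop heq
      exact hij ((Nat.mod_eq_of_lt hi).symm.trans (Eq.trans h2 (Nat.mod_eq_of_lt hj)))
    · have : -t ≤ ((p - 1 : ℕ) : ℤ) / s := by
        rw [Int.le_ediv_iff_mul_le hs']
        push_cast [hp.one_le]
        nlinarith
      have h3 : ((p - 1 : ℕ) : ℤ) / s = r := by rw [hr]; push_cast; rfl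
      linarith
    · have : t ≤ ((p - 1 : ℕ) : ℤ) / s := by
        rw [Int.le_ediv_iff_mul_le hs']
        push_cast [hp.one_le]
        nlinarith
      have h3 : ((p - 1 : ℕ) : ℤ) / s = r := by rw [hr]; push_cast; rfl
      linarith
  have hinj : Set.InjOn (fun a : ℕ => (((a * i % p : ℕ) : ℤ) - ((a * j % p : ℕ) : ℤ)) / s)
      ((Finset.Icc 1 (p - 1)).filter fun a => hashNat p a s i = hashNat p a s j) := by
    intro a ha a' ha' h
    rw [Finset.mem_coe, Finset.mem_filter, Finset.mem_Icc] at ha ha'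
    have hd : ∀ a, hashNat p a s i = hashNat p a s j →
        (s : ℤ) ∣ ((a * i % p : ℕ) : ℤ) - ((a * j % p : ℕ) : ℤ) :=
      fun a ha => Nat.modEq_iff_dvd.1 (Eq.symm ha)
    have h' : ((a * i % p : ℕ) : ℤ) - ((a * j % p : ℕ) : ℤ) =
        ((a' * i % p : ℕ) : ℤ) - ((a' * j % p : ℕ) : ℤ) := by
      rw [← Int.ediv_mul_cancel (hd a ha.2), ← Int.ediv_mul_cancel (hd a' ha'.2)]
      exact congrArg (· * (s : ℤ)) h
    have : Fact p.Prime := ⟨hp⟩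
    have hz : (a : ZMod p) * (i - j) = a' * (i - j) := by
      have := congrArg (Int.cast : ℤ → ZMod p) h'
      simp only [Int.cast_sub, Int.cast_natCast, ZMod.natCast_mod] at this
      push_cast at this
      linear_combination this
    have hne : ((i : ZMod p) - j) ≠ 0 := by
      rw [sub_ne_zero]
      intro h
      rw [ZMod.natCast_eq_natCast_iff] at h
      exact hij ((Nat.mod_eq_of_lt hi).symm.trans (Eq.trans h (Nat.mod_eq_of_lt hj)))
    have := mul_right_cancel₀ hne hz
    rw [ZMod.natCast_eq_natCast_iff] at this
    have e : a % p = a' % p := this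
    rwa [Nat.mod_eq_of_lt (by omega), Nat.mod_eq_of_lt (by omega)] at e
  have hcard := Finset.card_le_card_of_injOn _ hmaps hinj
  have h0 : ((Finset.Icc (-r : ℤ) r).erase 0).card = 2 * r := by
    rw [Finset.card_erase_of_mem (by simp), Int.card_Icc]
    omega
  rw [h0] at hcard
  calc _ ≤ 2 * r * s := Nat.mul_le_mul_right _ hcard
    _ = 2 * (r * s) := by ring
    _ ≤ 2 * (p - 1) := Nat.mul_le_mul_left _ (Nat.div_mul_le_self _ _)

/-- Some multiplier has at most the average number of collisions. -/
theorem exists_multiplier {p : ℕ} (s : ℕ) (hp : p.Prime) (K : Finset ℕ) (hK : ∀ i ∈ K, i < p) :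
    ∃ a ∈ Finset.Icc 1 (p - 1),
      (K.offDiag.filter fun x => hashNat p a s x.1 = hashNat p a s x.2).card * s ≤
        2 * K.offDiag.card := by
  have hne : (Finset.Icc 1 (p - 1)).Nonempty := by
    rw [Finset.nonempty_Icc]
    have := hp.two_le
    omega
  refine Finset.exists_le_of_sum_le hne ?_
  rw [← Finset.sum_mul]
  simp only [Finset.card_filter]
  rw [Finset.sum_comm, Finset.sum_mul]
  calc _ ≤ ∑ x ∈ K.offDiag, 2 * (p - 1) := by
        refine Finset.sum_le_sum fun x hx => ?_
        obtain ⟨h1, h2, h3⟩ := Finset.mem_offDiag.1 hx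
        rw [← Finset.card_filter]
        exact card_collision_mul_le hp (hK _ h1) (hK _ h2) h3
    _ = _ := by
        rw [Finset.sum_const, Finset.sum_const, Nat.card_Icc, smul_eq_mul, smul_eq_mul,
          Nat.add_sub_cancel]
        ring

theorem sum_card_fiber_sq (K : Finset ℕ) (h : ℕ → ℕ) (k : ℕ) (hk : ∀ i ∈ K, h i < k) :
    ∑ b ∈ Finset.range k, (K.filter fun i => h i = b).card ^ 2 =
      (K.offDiag.filter fun x => h x.1 = h x.2).card + K.card := by
  have h1 : ∀ b, (K.filter fun i => h i = b).card ^ 2 =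
      ((K.filter fun i => h i = b).offDiag).card + (K.filter fun i => h i = b).card := by
    intro b
    rw [Finset.offDiag_card, sq]
    exact (Nat.sub_add_cancel (Nat.le_mul_self _)).symm
  simp only [h1]
  rw [Finset.sum_add_distrib]
  congr 1
  · rw [Finset.card_eq_sum_card_fiberwise (f := fun x => h x.1) (t := Finset.range k)]
    · refine Finset.sum_congr rfl fun b _ => congrArg Finset.card ?_
      ext x
      simp only [Finset.mem_offDiag, Finset.mem_filter]
      constructor
      · rintro ⟨⟨a1, a2⟩, ⟨a3, a4⟩, a5⟩
        exact ⟨⟨⟨a1, a3, a5⟩, a2.trans a4.symm⟩, a2⟩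
      · rintro ⟨⟨⟨a1, a3, a5⟩, a4⟩, a2⟩
        exact ⟨⟨a1, a2⟩, ⟨a3, a4.symm.trans a2⟩, a5⟩
    · intro x hx
      have hx' := Finset.mem_coe.1 hx
      simp only [Finset.mem_filter, Finset.mem_offDiag] at hx'
      simpa using hk _ hx'.1.1
  · rw [Finset.card_eq_sum_card_fiberwise (f := h) (t := Finset.range k)]
    intro x hx
    simpa using hk _ hx

/-- Two-level perfect hashing: a set of at most `k` keys has an injective hash function into
`{0, …, 7 k - 1}` that consists of a hash function with range `k` and a further hash function for
each of its values. -/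
theorem exists_perfect_hash {p k : ℕ} (hp : p.Prime) (hk : 1 ≤ k) (K : Finset ℕ)
    (hK : ∀ i ∈ K, i < p) (hKk : K.card ≤ k) :
    ∃ (a : ℕ) (A S O : ℕ → ℕ), a < p ∧ (∀ b, A b < p) ∧ (∀ b, 0 < S b) ∧
      (∀ b < k, O b + S b ≤ 7 * k) ∧
      Set.InjOn (fun i => O (hashNat p a k i) +
        hashNat p (A (hashNat p a k i)) (S (hashNat p a k i)) i) (K : Set ℕ) := by
  obtain ⟨a, ha, hcoll⟩ := exists_multiplier k hp K hK
  rw [Finset.mem_Icc] at ha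
  have hp0 := hp.pos
  set F : ℕ → Finset ℕ := fun b => K.filter fun i => hashNat p a k i = b with hF
  have hA : ∀ b, ∃ a' < p, Set.InjOn (hashNat p a' (2 * (F b).card ^ 2 + 1)) (F b : Set ℕ) := by
    intro b
    obtain ⟨a', ha', hc⟩ := exists_multiplier (2 * (F b).card ^ 2 + 1) hp (F b)
      fun i hi => hK i (Finset.mem_filter.1 hi).1
    rw [Finset.mem_Icc] at ha'
    refine ⟨a', by omega, ?_⟩
    have hle : (F b).offDiag.card ≤ (F b).card ^ 2 := by
      rw [Finset.offDiag_card, sq]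
      exact Nat.sub_le _ _
    intro i hi j hj hij
    by_contra hne
    have hpos : 0 < ((F b).offDiag.filter fun x => hashNat p a' (2 * (F b).card ^ 2 + 1) x.1 =
        hashNat p a' (2 * (F b).card ^ 2 + 1) x.2).card :=
      Finset.card_pos.2 ⟨(i, j), by
        simp only [Finset.mem_filter, Finset.mem_offDiag]
        exact ⟨⟨hi, hj, hne⟩, hij⟩⟩
    nlinarith
  choose A hAp hAinj using hA
  set S : ℕ → ℕ := fun b => 2 * (F b).card ^ 2 + 1 with hS
  have hSpos : ∀ b, 0 < S b := fun b => Nat.succ_pos _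
  set O : ℕ → ℕ := fun b => ∑ c ∈ Finset.range b, S c with hO
  have hOsucc : ∀ b, O (b + 1) = O b + S b := fun b => Finset.sum_range_succ _ _
  have hOmono : Monotone O := monotone_nat_of_le_succ fun b => by rw [hOsucc]; omega
  have hmem : ∀ i ∈ K, hashNat p a k i < k := fun i _ => Nat.mod_lt _ hk
  have hOk : O k ≤ 7 * k := by
    have h1 : O k = 2 * ∑ b ∈ Finset.range k, (F b).card ^ 2 + k := by
      simp only [hO, hS]
      rw [Finset.sum_add_distrib, ← Finset.mul_sum]
      simp
    have h2 : ∑ b ∈ Finset.range k, (F b).card ^ 2 = _ := sum_card_fiber_sq K _ k hmem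
    have h3 : K.offDiag.card ≤ k * k := by
      rw [Finset.offDiag_card]
      exact (Nat.sub_le _ _).trans (Nat.mul_le_mul hKk hKk)
    have h4 : (K.offDiag.filter fun x => hashNat p a k x.1 = hashNat p a k x.2).card ≤ 2 * k :=
      Nat.le_of_mul_le_mul_right (hcoll.trans (by nlinarith)) hk
    omega
  refine ⟨a, A, S, O, by omega, hAp, hSpos, ?_, ?_⟩
  · intro b hb
    rw [← hOsucc]
    exact (hOmono hb).trans hOk
  · intro i hi j hj hij
    have key : ∀ i j, hashNat p a k i < hashNat p a k j →
        O (hashNat p a k i) + hashNat p (A (hashNat p a k i)) (S (hashNat p a k i)) i <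
        O (hashNat p a k j) + hashNat p (A (hashNat p a k j)) (S (hashNat p a k j)) j := by
      intro i j h
      have h1 : hashNat p (A (hashNat p a k i)) (S (hashNat p a k i)) i < S (hashNat p a k i) :=
        Nat.mod_lt _ (hSpos _)
      have h2 := hOmono (Nat.succ_le_of_lt h)
      rw [Nat.succ_eq_add_one, hOsucc] at h2
      omega
    dsimp only at hij
    rcases lt_trichotomy (hashNat p a k i) (hashNat p a k j) with h | h | h
    · exact absurd hij (key i j h).ne
    · rw [h] at hij
      refine hAinj (hashNat p a k j) ?_ ?_ (Nat.add_left_cancel hij)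
      · exact Finset.mem_coe.2 (Finset.mem_filter.2 ⟨hi, h⟩)
      · exact Finset.mem_coe.2 (Finset.mem_filter.2 ⟨hj, rfl⟩)
    · exact absurd hij (key j i h).ne'

/-- Packing of `q` numbers below `B` into a number below `B ^ q`. -/
theorem exists_packed_word (B : ℕ) (hB : 0 < B) (q : ℕ) (f : ℕ → ℕ) (hf : ∀ t, f t < B) :
    ∃ W < B ^ q, ∀ t < q, W / B ^ t % B = f t := by
  induction q generalizing f with
  | zero => exact ⟨0, by simp, by simp⟩
  | succ q ih =>
    obtain ⟨W, hW, hW'⟩ := ih (fun t => f (t + 1)) fun t => hf _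
    refine ⟨f 0 + B * W, ?_, ?_⟩
    · have := hf 0
      rw [pow_succ]
      nlinarith
    · intro t ht
      have hdiv : (f 0 + B * W) / B = W := by
        rw [Nat.add_mul_div_left _ _ hB, Nat.div_eq_of_lt (hf 0), zero_add]
      rcases t with _ | t
      · simp [Nat.mod_eq_of_lt (hf 0)]
      · rw [pow_succ', ← Nat.div_div_eq_div_mul, hdiv]
        exact hW' t (by omega)

namespace WordRAM

variable {w : ℕ}

theorem toNat_mul_eq {x y : BitVec w} {a b : ℕ} (hx : x.toNat = a) (hy : y.toNat = b)
    (h : a * b < 2 ^ w) : (x * y).toNat = a * b := by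
  rw [BitVec.toNat_mul, hx, hy, Nat.mod_eq_of_lt h]

theorem toNat_add_eq {x y : BitVec w} {a b : ℕ} (hx : x.toNat = a) (hy : y.toNat = b)
    (h : a + b < 2 ^ w) : (x + y).toNat = a + b := by
  rw [BitVec.toNat_add, hx, hy, Nat.mod_eq_of_lt h]

theorem toNat_ofNat_eq {a : ℕ} (h : a < 2 ^ w) : (BitVec.ofNat w a).toNat = a := by
  rw [BitVec.toNat_ofNat, Nat.mod_eq_of_lt h]

/-- The memory with array `f < 8` stored in the cells congruent to `f` modulo `8`. -/
def interleave (w N : ℕ) (F : ℕ → ℕ → ℕ) : List (BitVec w) :=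
  (List.range (8 * N)).map fun t => BitVec.ofNat w (F (t % 8) (t / 8))

theorem toNat_getD_interleave {N : ℕ} {F : ℕ → ℕ → ℕ} {f j : ℕ} {x : BitVec w} (hf : f < 8)
    (hj : j < N) (hF : F f j < 2 ^ w) (hx : x.toNat = j * 8 + f) :
    ((interleave w N F).getD x.toNat 0#w).toNat = F f j := by
  have hlt : j * 8 + f < 8 * N := by omega
  rw [hx, List.getD_eq_getElem?_getD, interleave, List.getElem?_map, List.getElem?_range hlt]
  have h1 : (j * 8 + f) % 8 = f := by omega
  have h2 : (j * 8 + f) / 8 = j := by omega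
  simp [h1, h2, Nat.mod_eq_of_lt hF]

/-- The data structure for the dictionary `i ↦ val i` with the keys `K` and the packed buckets
`W`. -/
theorem exists_dataStructure {p u k a s q b : ℕ} (hp : p.Prime) (hup : u ≤ p) (hk : 1 ≤ k)
    (K : Finset ℕ) (hK : ∀ i ∈ K, i < u) (hKk : K.card ≤ k) (val W : ℕ → ℕ) (ha : a < p)
    (hq : 1 ≤ q) (hpu : p * u < 2 ^ w) (hk64 : 64 * k < 2 ^ w) (hval : ∀ i, val i < 2 ^ w)
    (hW : ∀ j, W j < 2 ^ w) (hs : s < 2 ^ w) (hqb : q * b < 2 ^ w) (hb : b < w) (hqw : q < 2 ^ w)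
    (hu : 1 ≤ u) (hbucket : ∀ i < u, i ∉ K → hashNat p a s i / q < 8 * k) :
    ∃ D : List (BitVec w), D.length = 64 * k ∧ ∀ i < u,
      accessTime lookupProgram D i ≤ 52 ∧ answer lookupProgram D i =
        if i ∈ K then val i else
          W (hashNat p a s i / q) / 2 ^ (hashNat p a s i % q * b) % 2 ^ b := by
  classical
  obtain ⟨a₁, A, S, O, ha₁, hA, hS, hO, hinj⟩ := exists_perfect_hash hp hk K
    (fun i hi => (hK i hi).trans_le hup) hKk
  set cell : ℕ → ℕ := fun i => O (hashNat p a₁ k i) +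
    hashNat p (A (hashNat p a₁ k i)) (S (hashNat p a₁ k i)) i with hcell
  set key : ℕ → ℕ := fun g => if h : ∃ i ∈ K, cell i = g then h.choose else u with hkey
  have hkey_mem : ∀ i ∈ K, key (cell i) = i := by
    intro i hi
    have h : ∃ j ∈ K, cell j = cell i := ⟨i, hi, rfl⟩
    simp only [hkey, dif_pos h]
    exact hinj h.choose_spec.1 hi h.choose_spec.2
  have hkey_notMem : ∀ i < u, i ∉ K → ∀ g, key g ≠ i := by
    intro i hiu hi g
    by_cases h : ∃ j ∈ K, cell j = g
    · simp only [hkey, dif_pos h]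
      rintro rfl
      exact hi h.choose_spec.1
    · simp only [hkey, dif_neg h]
      exact hiu.ne'
  have hkey_le : ∀ g, key g ≤ u := by
    intro g
    by_cases h : ∃ j ∈ K, cell j = g
    · simp only [hkey, dif_pos h]
      exact (hK _ h.choose_spec.1).le
    · simp only [hkey, dif_neg h, le_refl]
  have hpw : p < 2 ^ w := lt_of_le_of_lt (by nlinarith) hpu
  have huw : u < 2 ^ w := hup.trans_lt hpw
  have hw0 : w ≠ 0 := by omega
  have hp0 := hp.pos
  set F : ℕ → ℕ → ℕ := fun f j =>
    match f with
    | 0 => (match j with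
      | 0 => p | 1 => a₁ | 2 => k | 3 => a | 4 => s | 5 => q | 6 => b | 7 => 2 ^ b | _ => 0)
    | 1 => A j
    | 2 => if j < k then S j else 0
    | 3 => if j < k then O j else 0
    | 4 => key j
    | 5 => val (key j)
    | 6 => W j
    | _ => 0 with hFdef
  refine ⟨interleave w (8 * k) F, by rw [interleave, List.length_map, List.length_range]; ring,
    fun i hi => ?_⟩
  obtain ⟨h1, h2⟩ := lookupProgram_spec hw0 (interleave w (8 * k) F) i
  refine ⟨h1, ?_⟩
  rw [h2]
  set m : BitVec w → BitVec w := fun a => (interleave w (8 * k) F).getD a.toNat 0#w with hm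
  have load : ∀ {f j : ℕ} {x : BitVec w}, f < 8 → j < 8 * k → F f j < 2 ^ w →
      x.toNat = j * 8 + f → (m x).toNat = F f j :=
    fun h1 h2 h3 h4 => toNat_getD_interleave h1 h2 h3 h4
  have hbw : b < 2 ^ w := hb.trans Nat.lt_two_pow_self
  have h2b : 2 ^ b < 2 ^ w := Nat.pow_lt_pow_right (by norm_num) hb
  have head : ∀ j < 8, F 0 j < 2 ^ w → (header m j).toNat = F 0 j := by
    intro j hj hF
    refine load (f := 0) (j := j) (by norm_num) (by omega) hF ?_
    rw [toNat_ofNat_eq (by omega)]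
    ring
  have H0 : (header m 0).toNat = p := head 0 (by norm_num) hpw
  have H1 : (header m 1).toNat = a₁ := head 1 (by norm_num) (ha₁.trans hpw)
  have H2 : (header m 2).toNat = k := head 2 (by norm_num) (show k < 2 ^ w by omega)
  have H3 : (header m 3).toNat = a := head 3 (by norm_num) (ha.trans hpw)
  have H4 : (header m 4).toNat = s := head 4 (by norm_num) hs
  have H5 : (header m 5).toNat = q := head 5 (by norm_num) hqw
  have H6 : (header m 6).toNat = b := head 6 (by norm_num) hbw
  have H7 : (header m 7).toNat = 2 ^ b := head 7 (by norm_num) h2b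
  set x := BitVec.ofNat w i with hx
  have hxi : x.toNat = i := toNat_ofNat_eq (hi.trans huw)
  have hash : ∀ {y z : BitVec w} {c t : ℕ}, c < p → y.toNat = c → z.toNat = t →
      (hashWord m y z x).toNat = hashNat p c t i := by
    intro y z c t hc hy hz
    rw [hashWord, BitVec.toNat_umod, BitVec.toNat_umod, toNat_mul_eq hy hxi, H0, hz, hashNat]
    exact lt_of_le_of_lt (Nat.mul_le_mul hc.le hi.le) hpu
  set t := hashNat p a₁ k i with ht
  have htk : t < k := Nat.mod_lt _ hk
  have n1 : (1#w).toNat = 1 := toNat_ofNat_eq (by omega)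
  have n4 : (4#w).toNat = 4 := toNat_ofNat_eq (by omega)
  have n6 : (6#w).toNat = 6 := toNat_ofNat_eq (by omega)
  have n8 : (8#w).toNat = 8 := toNat_ofNat_eq (by omega)
  have T0 : (topAddr m x).toNat = t * 8 := toNat_mul_eq (hash ha₁ H1 H2) n8 (by omega)
  have T1 := toNat_add_eq T0 n1 (by omega)
  have T2 := toNat_add_eq T1 n1 (by omega)
  have T3 := toNat_add_eq T2 n1 (by omega)
  have hOt := hO t htk
  have hSt := hS t
  have FS : F 2 t = S t := if_pos htk
  have FO : F 3 t = O t := if_pos htk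
  have M1 : (m (topAddr m x + 1#w)).toNat = A t :=
    load (f := 1) (by norm_num) (by omega) ((hA t).trans hpw) T1
  have M2 : (m (topAddr m x + 1#w + 1#w)).toNat = S t :=
    (load (f := 2) (by norm_num) (by omega) (by rw [FS]; omega) T2).trans FS
  have M3 : (m (topAddr m x + 1#w + 1#w + 1#w)).toNat = O t :=
    (load (f := 3) (by norm_num) (by omega) (by rw [FO]; omega) T3).trans FO
  have hlt : hashNat p (A t) (S t) i < S t := Nat.mod_lt _ hSt
  have C0 : (cellAddr m x).toNat = cell i * 8 + 4 := by
    refine toNat_add_eq (toNat_mul_eq ?_ n8 ?_) n4 ?_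
    · rw [toNat_add_eq (hash (hA t) M1 M2) M3 (by omega), add_comm]
    · simp only [hcell, ← ht]
      omega
    · simp only [hcell, ← ht]
      omega
  have hcell_lt : cell i < 8 * k := by
    simp only [hcell, ← ht]
    omega
  have C1 := toNat_add_eq C0 n1 (by omega)
  have M4 : (m (cellAddr m x)).toNat = key (cell i) :=
    load (f := 4) (by norm_num) hcell_lt ((hkey_le _).trans_lt huw) C0
  have M5 : (m (cellAddr m x + 1#w)).toNat = val (key (cell i)) :=
    load (f := 5) (by norm_num) hcell_lt (hval _) C1
  by_cases hiK : i ∈ K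
  · have heq : m (cellAddr m x) = x := by
      apply BitVec.eq_of_toNat_eq
      rw [M4, hxi, hkey_mem i hiK]
    rw [lookupValue, if_pos heq, if_pos hiK, M5, hkey_mem i hiK]
  · have hne : m (cellAddr m x) ≠ x := by
      intro h
      rw [h, hxi] at M4
      exact hkey_notMem i hi hiK _ M4.symm
    rw [lookupValue, if_neg hne, if_neg hiK]
    have B0 : (bucketWord m x).toNat = hashNat p a s i := hash ha H3 H4
    have hB := hbucket i hi hiK
    set h := hashNat p a s i with hh
    have B1 : (bucketWord m x / header m 5).toNat = h / q := by
      rw [BitVec.toNat_udiv, B0, H5]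
    have B2 : (bucketWord m x % header m 5).toNat = h % q := by
      rw [BitVec.toNat_umod, B0, H5]
    have hmod : h % q < q := Nat.mod_lt _ hq
    have B3 : (bucketWord m x % header m 5 * header m 6).toNat = h % q * b :=
      toNat_mul_eq B2 H6 (lt_of_le_of_lt (Nat.mul_le_mul_right _ hmod.le) hqb)
    have B4 := toNat_add_eq (toNat_mul_eq B1 n8 (by omega)) n6 (by omega)
    have B5 : (m (bucketWord m x / header m 5 * 8#w + 6#w)).toNat = W (h / q) :=
      load (f := 6) (by norm_num) hB (hW _) B4
    rw [bucketValue, BitVec.toNat_umod, BitVec.toNat_ushiftRight, B5, B3, H7,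
      Nat.shiftRight_eq_div_pow]

end WordRAM

namespace PMF

variable {α β : Type*}

theorem expectation_mono (p : PMF α) {f g : α → ℝ≥0∞} (h : ∀ a, f a ≤ g a) :
    p.expectation f ≤ p.expectation g :=
  ENNReal.tsum_le_tsum fun a => by gcongr; exact h a

theorem expectation_const (p : PMF α) (c : ℝ≥0∞) : (p.expectation fun _ => c) = c := by
  rw [expectation, ENNReal.tsum_mul_right, p.tsum_coe, one_mul]

theorem expectation_add (p : PMF α) (f g : α → ℝ≥0∞) :
    (p.expectation fun a => f a + g a) = p.expectation f + p.expectation g := by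
  simp only [expectation, mul_add, ENNReal.tsum_add]

theorem expectation_const_mul (p : PMF α) (c : ℝ≥0∞) (f : α → ℝ≥0∞) :
    (p.expectation fun a => c * f a) = c * p.expectation f := by
  simp only [expectation, ← ENNReal.tsum_mul_left]
  exact tsum_congr fun a => by ring

theorem expectation_finset_sum (p : PMF α) {ι : Type*} (s : Finset ι) (f : ι → α → ℝ≥0∞) :
    (p.expectation fun a => ∑ i ∈ s, f i a) = ∑ i ∈ s, p.expectation (f i) := by
  classical
  induction s using Finset.induction_on with
  | empty => simp [expectation]
  | insert i s hi ih => simp only [Finset.sum_insert hi, expectation_add, ih]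

theorem expectation_pure (a : α) (f : α → ℝ≥0∞) : (pure a).expectation f = f a := by
  rw [expectation, tsum_eq_single a]
  · simp
  · intro b hb
    simp [hb]

theorem expectation_bind (p : PMF α) (q : α → PMF β) (f : β → ℝ≥0∞) :
    (p.bind q).expectation f = p.expectation fun a => (q a).expectation f := by
  simp only [expectation, bind_apply, ← ENNReal.tsum_mul_right, ← ENNReal.tsum_mul_left]
  rw [ENNReal.tsum_comm]
  exact tsum_congr fun a => tsum_congr fun b => mul_assoc _ _ _

theorem toOuterMeasure_le_expectation (p : PMF α) {A : Set α} {f : α → ℝ≥0∞}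
    (h : ∀ a ∈ A, 1 ≤ f a) : p.toOuterMeasure A ≤ p.expectation f := by
  rw [toOuterMeasure_apply]
  refine ENNReal.tsum_le_tsum fun a => ?_
  by_cases ha : a ∈ A
  · rw [Set.indicator_of_mem ha]
    exact le_mul_of_one_le_right' (h a ha)
  · rw [Set.indicator_of_notMem ha]
    exact zero_le

theorem bind_apply_le {p p' : PMF α} {q q' : α → PMF β} {c c' : ℝ≥0∞}
    (hp : ∀ a, p a ≤ c * p' a) (hq : ∀ a b, q a b ≤ c' * q' a b) (b : β) :
    p.bind q b ≤ c * c' * p'.bind q' b := by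
  simp only [bind_apply, ← ENNReal.tsum_mul_left]
  refine ENNReal.tsum_le_tsum fun a => ?_
  calc p a * q a b ≤ (c * p' a) * (c' * q' a b) := mul_le_mul' (hp a) (hq a b)
    _ = _ := by ring

theorem toOuterMeasure_le_of_apply_le {p p' : PMF α} {c : ℝ≥0∞} (h : ∀ a, p a ≤ c * p' a)
    (A : Set α) : p.toOuterMeasure A ≤ c * p'.toOuterMeasure A := by
  simp only [toOuterMeasure_apply, ← ENNReal.tsum_mul_left]
  refine ENNReal.tsum_le_tsum fun a => ?_
  by_cases ha : a ∈ A <;> simp [ha, h a]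

variable {ι : Type*} [Fintype ι] [DecidableEq ι] [Fintype β]

/-- The product of finitely many probability mass functions on a finite type. -/
noncomputable def piFintype (p : ι → PMF β) : PMF (ι → β) :=
  ofFintype (fun z => ∏ i, p i (z i)) <| by
    have h := Finset.prod_univ_sum (fun _ : ι => (Finset.univ : Finset β)) fun i b => p i b
    rw [Fintype.piFinset_univ] at h
    rw [← h]
    refine Finset.prod_eq_one fun i _ => ?_
    rw [← tsum_fintype (L := .unconditional _), (p i).tsum_coe]

theorem piFintype_apply (p : ι → PMF β) (z : ι → β) : piFintype p z = ∏ i, p i (z i) := rfl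

theorem expectation_piFintype (p : ι → PMF β) (i : ι) (f : β → ℝ≥0∞) :
    ((piFintype p).expectation fun z => f (z i)) = (p i).expectation f := by
  have h := Finset.prod_univ_sum (fun _ : ι => (Finset.univ : Finset β))
    fun j b => p j b * if j = i then f b else 1
  rw [Fintype.piFinset_univ] at h
  rw [expectation, tsum_fintype, expectation, tsum_fintype]
  calc _ = ∑ z : ι → β, ∏ j, p j (z j) * (if j = i then f (z j) else 1) := by
        refine Finset.sum_congr rfl fun z _ => ?_
        rw [Finset.prod_mul_distrib, piFintype_apply, Finset.prod_ite_eq' Finset.univ i]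
        simp
    _ = ∏ j, ∑ b, p j b * (if j = i then f b else 1) := h.symm
    _ = _ := by
        rw [Finset.prod_eq_single i]
        · simp
        · intro j _ hj
          simp only [if_neg hj, mul_one]
          rw [← tsum_fintype (L := .unconditional _), (p j).tsum_coe]
        · simp

end PMF

/-! ### Noise -/

/-- The weight of `z` in the discrete Laplace distribution around `x`. -/
noncomputable def laplaceWeight (m : ℕ) (δ : ℝ) (x : ℕ) (z : Fin (m + 1)) : ℝ≥0∞ :=
  ENNReal.ofReal (Real.exp (-(δ * |(z : ℝ) - x|)))

theorem tsum_laplaceWeight_ne_zero (m : ℕ) (δ : ℝ) (x : ℕ) :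
    ∑' z, laplaceWeight m δ x z ≠ 0 := by
  intro h
  have := ENNReal.tsum_eq_zero.1 h 0
  rw [laplaceWeight, ENNReal.ofReal_eq_zero] at this
  exact absurd this (not_le.2 (Real.exp_pos _))

theorem tsum_laplaceWeight_ne_top (m : ℕ) (δ : ℝ) (x : ℕ) :
    ∑' z, laplaceWeight m δ x z ≠ ∞ := by
  rw [tsum_fintype]
  exact ENNReal.sum_ne_top.2 fun _ _ => ENNReal.ofReal_ne_top

/-- The discrete Laplace distribution around `x` on `{0, …, m}`. -/
noncomputable def discreteLaplace (m : ℕ) (δ : ℝ) (x : ℕ) : PMF (Fin (m + 1)) :=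
  PMF.normalize (laplaceWeight m δ x) (tsum_laplaceWeight_ne_zero m δ x)
    (tsum_laplaceWeight_ne_top m δ x)

theorem laplaceWeight_le (m : ℕ) {δ : ℝ} (hδ : 0 ≤ δ) (x y : ℕ) (z : Fin (m + 1)) :
    laplaceWeight m δ x z ≤
      ENNReal.ofReal (Real.exp (δ * |(x : ℝ) - y|)) * laplaceWeight m δ y z := by
  rw [laplaceWeight, laplaceWeight, ← ENNReal.ofReal_mul (Real.exp_pos _).le, ← Real.exp_add]
  refine ENNReal.ofReal_le_ofReal (Real.exp_le_exp.2 ?_)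
  have h1 : |(z : ℝ) - y| ≤ |(z : ℝ) - x| + |(x : ℝ) - y| := abs_sub_le _ _ _
  nlinarith

theorem discreteLaplace_apply_le (m : ℕ) {δ : ℝ} (hδ : 0 ≤ δ) (x y : ℕ) (z : Fin (m + 1)) :
    discreteLaplace m δ x z ≤
      ENNReal.ofReal (Real.exp (2 * δ * |(x : ℝ) - y|)) * discreteLaplace m δ y z := by
  set c := ENNReal.ofReal (Real.exp (δ * |(x : ℝ) - y|)) with hc
  have hc0 : c ≠ 0 := by simp [hc, Real.exp_pos]
  have hct : c ≠ ∞ := ENNReal.ofReal_ne_top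
  have hcc : ENNReal.ofReal (Real.exp (2 * δ * |(x : ℝ) - y|)) = c * c := by
    rw [hc, ← ENNReal.ofReal_mul (Real.exp_pos _).le, ← Real.exp_add]
    ring_nf
  have hZ : ∑' z, laplaceWeight m δ y z ≤ c * ∑' z, laplaceWeight m δ x z := by
    rw [← ENNReal.tsum_mul_left]
    refine ENNReal.tsum_le_tsum fun z => ?_
    rw [hc, abs_sub_comm]
    exact laplaceWeight_le m hδ y x z
  have hZ' : (∑' z, laplaceWeight m δ x z)⁻¹ ≤ c * (∑' z, laplaceWeight m δ y z)⁻¹ := by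
    have h := mul_le_mul_right (ENNReal.inv_le_inv.2 hZ) c
    rwa [ENNReal.mul_inv (Or.inl hc0) (Or.inl hct), ← mul_assoc, ENNReal.mul_inv_cancel hc0 hct,
      one_mul] at h
  rw [discreteLaplace, discreteLaplace, PMF.normalize_apply, PMF.normalize_apply, hcc]
  calc _ ≤ (c * laplaceWeight m δ y z) * (c * (∑' z, laplaceWeight m δ y z)⁻¹) :=
        mul_le_mul' (laplaceWeight_le m hδ x y z) hZ'
    _ = _ := by ring

theorem geom_sum_le_two_mul {r : ℝ} (h1 : r ≤ 1) (k : ℕ) :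
    ∑ d ∈ Finset.range k, r ^ d ≤ 2 * ∑ d ∈ Finset.range k, (r ^ 2) ^ d := by
  induction k using Nat.twoStepInduction with
  | zero => simp
  | one => norm_num
  | more k ih _ =>
    have hS : ∑ d ∈ Finset.range (k + 2), r ^ d = r ^ 2 * ∑ d ∈ Finset.range k, r ^ d + (r + 1) := by
      rw [Finset.sum_range_succ', Finset.sum_range_succ', Finset.mul_sum]
      simp only [pow_add]
      ring_nf
    have hT : ∑ d ∈ Finset.range (k + 1), (r ^ 2) ^ d =
        r ^ 2 * ∑ d ∈ Finset.range k, (r ^ 2) ^ d + 1 := by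
      rw [Finset.sum_range_succ', Finset.mul_sum]
      simp only [pow_succ]
      ring_nf
    have hT' : ∑ d ∈ Finset.range (k + 2), (r ^ 2) ^ d =
        ∑ d ∈ Finset.range (k + 1), (r ^ 2) ^ d + (r ^ 2) ^ (k + 1) := Finset.sum_range_succ _ _
    have h2 : 0 ≤ (r ^ 2) ^ (k + 1) := by positivity
    nlinarith [mul_le_mul_of_nonneg_left ih (sq_nonneg r)]

theorem sum_range_pow_dist (r : ℝ) {x m : ℕ} (hx : x ≤ m) :
    ∑ z ∈ Finset.range (m + 1), r ^ (max x z - min x z) =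
      r * ∑ d ∈ Finset.range x, r ^ d + ∑ d ∈ Finset.range (m - x + 1), r ^ d := by
  rw [show m + 1 = x + (m - x + 1) by omega, Finset.sum_range_add]
  congr 1
  · rw [← Finset.sum_range_reflect, Finset.mul_sum]
    refine Finset.sum_congr rfl fun z hz => ?_
    have := Finset.mem_range.1 hz
    rw [← pow_succ']
    congr 1
    omega
  · refine Finset.sum_congr rfl fun z _ => ?_
    congr 1
    omega

theorem sum_exp_dist_le (m : ℕ) {δ : ℝ} (hδ : 0 ≤ δ) {x : ℕ} (hx : x ≤ m) :
    ∑ z : Fin (m + 1), Real.exp (-(δ / 2 * |(z : ℝ) - x|)) ≤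
      4 * ∑ z : Fin (m + 1), Real.exp (-(δ * |(z : ℝ) - x|)) := by
  set r := Real.exp (-(δ / 2)) with hr
  have h1 : r ≤ 1 := Real.exp_le_one_iff.2 (by linarith)
  have hd : ∀ z : ℕ, |(z : ℝ) - x| = ((max x z - min x z : ℕ) : ℝ) := by
    intro z
    rcases le_total x z with h | h
    · rw [max_eq_right h, min_eq_left h, Nat.cast_sub h, abs_of_nonneg (by simpa using h)]
    · rw [max_eq_left h, min_eq_right h, Nat.cast_sub h, abs_of_nonpos (by simpa using h), neg_sub]
  have e1 : ∀ z : ℕ, Real.exp (-(δ / 2 * |(z : ℝ) - x|)) = r ^ (max x z - min x z) := by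
    intro z
    rw [hd, hr, ← Real.exp_nat_mul]
    ring_nf
  have e2 : ∀ z : ℕ, Real.exp (-(δ * |(z : ℝ) - x|)) = (r ^ 2) ^ (max x z - min x z) := by
    intro z
    rw [hd, hr, ← Real.exp_nat_mul, ← Real.exp_nat_mul]
    push_cast
    ring_nf
  simp only [e1, e2]
  rw [Fin.sum_univ_eq_sum_range (fun z => r ^ (max x z - min x z)) (m + 1),
    Fin.sum_univ_eq_sum_range (fun z => (r ^ 2) ^ (max x z - min x z)) (m + 1),
    sum_range_pow_dist _ hx, sum_range_pow_dist _ hx]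
  have g1 := geom_sum_le_two_mul h1 (x + 1)
  have g2 := geom_sum_le_two_mul h1 (m - x + 1)
  have s1 : ∀ r : ℝ, ∑ d ∈ Finset.range (x + 1), r ^ d = r * ∑ d ∈ Finset.range x, r ^ d + 1 := by
    intro r
    rw [Finset.sum_range_succ', Finset.mul_sum]
    simp only [pow_succ']
    ring
  rw [s1, s1] at g1
  have p1 : 1 ≤ ∑ d ∈ Finset.range (m - x + 1), (r ^ 2) ^ d := by
    rw [Finset.sum_range_succ']
    have : 0 ≤ ∑ d ∈ Finset.range (m - x), (r ^ 2) ^ (d + 1) :=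
      Finset.sum_nonneg fun _ _ => by positivity
    simpa using this
  have p2 : 0 ≤ ∑ d ∈ Finset.range x, (r ^ 2) ^ d := Finset.sum_nonneg fun _ _ => by positivity
  have p3 := mul_nonneg (sq_nonneg r) p2
  linarith

/-- The exponential moment of the discrete Laplace distribution. -/
theorem expectation_exp_discreteLaplace_le (m : ℕ) {δ : ℝ} (hδ : 0 ≤ δ) {x : ℕ} (hx : x ≤ m) :
    ((discreteLaplace m δ x).expectation fun z =>
      ENNReal.ofReal (Real.exp (δ / 2 * |(z : ℝ) - x|))) ≤ 4 := by
  have hZ0 := tsum_laplaceWeight_ne_zero m δ x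
  have hZt := tsum_laplaceWeight_ne_top m δ x
  have h : ∑' z : Fin (m + 1), ENNReal.ofReal (Real.exp (-(δ / 2 * |(z : ℝ) - x|))) ≤
      4 * ∑' z, laplaceWeight m δ x z := by
    simp only [laplaceWeight]
    rw [tsum_fintype, tsum_fintype, ← ENNReal.ofReal_sum_of_nonneg fun _ _ => (Real.exp_pos _).le,
      ← ENNReal.ofReal_sum_of_nonneg fun _ _ => (Real.exp_pos _).le,
      show (4 : ℝ≥0∞) = ENNReal.ofReal 4 by simp, ← ENNReal.ofReal_mul (by norm_num)]
    exact ENNReal.ofReal_le_ofReal (sum_exp_dist_le m hδ hx)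
  calc _ = (∑' z : Fin (m + 1), ENNReal.ofReal (Real.exp (-(δ / 2 * |(z : ℝ) - x|)))) *
        (∑' z, laplaceWeight m δ x z)⁻¹ := by
        rw [← ENNReal.tsum_mul_right, PMF.expectation]
        refine tsum_congr fun z => ?_
        rw [discreteLaplace, PMF.normalize_apply, mul_right_comm, laplaceWeight,
          ← ENNReal.ofReal_mul (Real.exp_pos _).le, ← Real.exp_add]
        congr 3
        ring_nf
    _ ≤ 4 * (∑' z, laplaceWeight m δ x z) * (∑' z, laplaceWeight m δ x z)⁻¹ := by gcongr
    _ = 4 := by rw [mul_assoc, ENNReal.mul_inv_cancel hZ0 hZt, mul_one]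

theorem Neighbouring.map {α β : Type*} [DecidableEq α] [DecidableEq β] {S T : Multiset α}
    (h : Neighbouring S T) (f : α → β) : Neighbouring (S.map f) (T.map f) := by
  have key : ∀ S T : Multiset α, (S.map f - T.map f).card ≤ (S - T).card := by
    intro S T
    have : S.map f - T.map f ≤ (S - T).map f := by
      rw [tsub_le_iff_right, ← Multiset.map_add]
      exact Multiset.map_le_map le_tsub_add
    simpa using Multiset.card_le_card this
  exact ⟨(key S T).trans h.1, (key T S).trans h.2⟩

theorem Neighbouring.sum_abs_count_sub_le {ι : Type*} [Fintype ι] [DecidableEq ι]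
    {S T : Multiset ι} (h : Neighbouring S T) :
    ∑ i, |(S.count i : ℝ) - T.count i| ≤ 2 := by
  have h1 : ∀ i, |(S.count i : ℝ) - T.count i| = ((S - T).count i : ℝ) + (T - S).count i := by
    intro i
    rw [Multiset.count_sub, Multiset.count_sub]
    rcases le_total (S.count i) (T.count i) with h | h
    · rw [Nat.sub_eq_zero_of_le h, Nat.cast_sub h, abs_of_nonpos (by simpa using h)]
      simp
    · rw [Nat.sub_eq_zero_of_le h, Nat.cast_sub h, abs_of_nonneg (by simpa using h)]
      simp
  simp only [h1]
  rw [Finset.sum_add_distrib, ← Nat.cast_sum, ← Nat.cast_sum,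
    Multiset.sum_count_eq_card fun _ _ => Finset.mem_univ _,
    Multiset.sum_count_eq_card fun _ _ => Finset.mem_univ _]
  have h2 := h.1
  have h3 := h.2
  exact_mod_cast Nat.add_le_add h2 h3

section noisyCounts

variable {ι : Type*} [Fintype ι] [DecidableEq ι]

/-- The multiplicities in `S` with independent discrete Laplace noise. -/
noncomputable def noisyCounts (m : ℕ) (δ : ℝ) (S : Multiset ι) : PMF (ι → Fin (m + 1)) :=
  PMF.piFintype fun i => discreteLaplace m δ (S.count i)

theorem noisyCounts_apply_le (m : ℕ) {δ : ℝ} (hδ : 0 ≤ δ) {S T : Multiset ι}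
    (h : Neighbouring S T) (z : ι → Fin (m + 1)) :
    noisyCounts m δ S z ≤ ENNReal.ofReal (Real.exp (4 * δ)) * noisyCounts m δ T z := by
  simp only [noisyCounts, PMF.piFintype_apply]
  calc _ ≤ ∏ i, ENNReal.ofReal (Real.exp (2 * δ * |(S.count i : ℝ) - T.count i|)) *
        discreteLaplace m δ (T.count i) (z i) :=
        Finset.prod_le_prod' fun i _ => discreteLaplace_apply_le m hδ _ _ _
    _ ≤ _ := by
        rw [Finset.prod_mul_distrib, ← ENNReal.ofReal_prod_of_nonneg fun _ _ => (Real.exp_pos _).le,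
          ← Real.exp_sum, ← Finset.mul_sum]
        refine mul_le_mul_left (ENNReal.ofReal_le_ofReal (Real.exp_le_exp.2 ?_)) _
        nlinarith [h.sum_abs_count_sub_le]

theorem expectation_exp_noisyCounts_le (m : ℕ) {δ : ℝ} (hδ : 0 ≤ δ) {S : Multiset ι}
    (hS : S.card ≤ m) (i : ι) :
    ((noisyCounts m δ S).expectation fun z =>
      ENNReal.ofReal (Real.exp (δ / 2 * |(z i : ℝ) - S.count i|))) ≤ 4 := by
  rw [noisyCounts, PMF.expectation_piFintype _ i fun v : Fin (m + 1) =>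
    ENNReal.ofReal (Real.exp (δ / 2 * |(v : ℝ) - S.count i|))]
  exact expectation_exp_discreteLaplace_le m hδ ((Multiset.count_le_card i S).trans hS)

theorem expectation_abs_noisyCounts_le (m : ℕ) {δ : ℝ} (hδ : 0 < δ) {S : Multiset ι}
    (hS : S.card ≤ m) (i : ι) :
    ((noisyCounts m δ S).expectation fun z => ENNReal.ofReal |(z i : ℝ) - S.count i|) ≤
      ENNReal.ofReal (8 / δ) := by
  calc _ ≤ (noisyCounts m δ S).expectation fun z => ENNReal.ofReal (2 / δ) *
        ENNReal.ofReal (Real.exp (δ / 2 * |(z i : ℝ) - S.count i|)) := by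
        refine PMF.expectation_mono _ fun z => ?_
        rw [← ENNReal.ofReal_mul (by positivity)]
        refine ENNReal.ofReal_le_ofReal ?_
        have := Real.add_one_le_exp (δ / 2 * |(z i : ℝ) - S.count i|)
        calc |(z i : ℝ) - S.count i| = 2 / δ * (δ / 2 * |(z i : ℝ) - S.count i|) := by
              field_simp
          _ ≤ _ := by gcongr; linarith
    _ ≤ ENNReal.ofReal (2 / δ) * 4 := by
        rw [PMF.expectation_const_mul]
        gcongr
        exact expectation_exp_noisyCounts_le m hδ.le hS i
    _ = _ := by
        rw [show (4 : ℝ≥0∞) = ENNReal.ofReal 4 by simp, ← ENNReal.ofReal_mul (by positivity)]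
        congr 1
        ring

end noisyCounts

/-! ### The mechanism -/

theorem exists_top_finset {α : Type*} [Fintype α] [DecidableEq α] (z : α → ℕ) (k : ℕ)
    (hk : k ≤ Fintype.card α) :
    ∃ K : Finset α, K.card = k ∧ ∀ i ∈ K, ∀ j ∉ K, z j ≤ z i := by
  induction k with
  | zero => exact ⟨∅, by simp, by simp⟩
  | succ k ih =>
    obtain ⟨K, hK, hKz⟩ := ih (by omega)
    have hne : Kᶜ.Nonempty := by
      rw [← Finset.card_pos, Finset.card_compl]
      omega
    obtain ⟨x, hx, hxmax⟩ := Finset.exists_max_image Kᶜ z hne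
    rw [Finset.mem_compl] at hx
    refine ⟨insert x K, by rw [Finset.card_insert_of_notMem hx, hK], ?_⟩
    intro i hi j hj
    rw [Finset.mem_insert, not_or] at hj
    rcases Finset.mem_insert.1 hi with rfl | hi
    · exact hxmax j (Finset.mem_compl.2 hj.2)
    · exact hKz i hi j hj.2

/-- A query data structure for the largest values of `z` and for the bucket values `v`. -/
theorem exists_lookupProgram_structure {w w₀ n u p q b T : ℕ} (hw : w = 8 * w₀)
    (hw₀ : u + n ≤ 2 ^ w₀) (hw₀2 : 2 ≤ w₀) (hu : 1 ≤ u) (hn : 1 ≤ n) (hp : p.Prime)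
    (hup : u ≤ p) (hpu : p ≤ 2 * u) (hb : b ≤ w₀) (hq : 1 ≤ q) (hqb : q * b ≤ w₀) (hqw : q ≤ w₀) (hT : T < 2 ^ b)
    (h : Fin u → Fin (n * q)) (a : ℕ) (hh : ∀ i, (h i : ℕ) = hashNat p a (n * q) i)
    (z : Fin u → Fin (n + 1)) (v : Fin (n * q) → Fin (n + 1)) :
    ∃ (D : List (BitVec w)) (K : Finset (Fin u)), D.length = 64 * min n u ∧
      K.card = min n u ∧ (∀ i ∈ K, ∀ j ∉ K, (z j : ℕ) ≤ z i) ∧ ∀ i : Fin u,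
        WordRAM.accessTime WordRAM.lookupProgram D i ≤ 52 ∧
        WordRAM.answer WordRAM.lookupProgram D i =
          if i ∈ K then (z i : ℕ) else min T (v (h i)) := by
  classical
  subst hw
  obtain ⟨K, hK, hKz⟩ := exists_top_finset (fun i => (z i : ℕ)) (min n u) (by simp)
  have hpack : ∀ j, ∃ W < (2 ^ b) ^ q, ∀ t < q, W / (2 ^ b) ^ t % 2 ^ b =
      if ht : j * q + t < n * q then min T (v ⟨j * q + t, ht⟩) else 0 := by
    intro j
    refine exists_packed_word (2 ^ b) (by positivity) q _ fun t => ?_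
    split_ifs
    · exact (min_le_left _ _).trans_lt hT
    · positivity
  choose W hW hWv using hpack
  set B := 2 ^ w₀ with hB
  have hB4 : 4 ≤ B := Nat.pow_le_pow_right (n := 2) (by norm_num) hw₀2
  have hwB : w₀ < B := Nat.lt_two_pow_self
  have hB2 : 4 * B ≤ B ^ 2 := by nlinarith
  have hB8 : 2 ^ (8 * w₀) = B ^ 8 := by rw [hB, ← pow_mul, mul_comm]
  have hB3 : 2 * B ^ 2 ≤ B ^ 8 := by
    calc 2 * B ^ 2 ≤ B * B ^ 2 := Nat.mul_le_mul_right _ (by omega)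
      _ = B ^ 3 := by ring
      _ ≤ B ^ 8 := Nat.pow_le_pow_right (by omega) (by norm_num)
  have hB5 : 64 * B ≤ B ^ 8 := by
    calc 64 * B = 4 ^ 3 * B := by norm_num
      _ ≤ B ^ 3 * B := Nat.mul_le_mul_right _ (Nat.pow_le_pow_left hB4 3)
      _ = B ^ 4 := by ring
      _ ≤ B ^ 8 := Nat.pow_le_pow_right (by omega) (by norm_num)
  have hhash : ∀ i, hashNat p (a % p) (n * q) i = hashNat p a (n * q) i := fun i => by
    simp [hashNat, Nat.mod_mul_mod]
  obtain ⟨D, hD, hDi⟩ := WordRAM.exists_dataStructure (w := 8 * w₀) (p := p) (u := u)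
    (k := min n u) (a := a % p) (s := n * q) (q := q) (b := b) hp hup (le_min hn hu)
    (K.map Fin.valEmbedding) (by simp) (by rw [Finset.card_map, hK])
    (fun i => if hi : i < u then z ⟨i, hi⟩ else 0) W (Nat.mod_lt _ hp.pos) hq
    (by rw [hB8]; nlinarith)
    (by rw [hB8]; have := min_le_left n u; omega)
    (by
      intro i
      rw [hB8]
      split_ifs with hi
      · have := (z ⟨i, hi⟩).isLt
        omega
      · omega)
    (by
      intro j
      refine (hW j).trans_le ?_
      rw [← pow_mul]
      refine Nat.pow_le_pow_right (by norm_num) ?_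
      nlinarith)
    (by rw [hB8]; nlinarith) (by rw [hB8]; omega) (by omega) (by rw [hB8]; omega) hu
    (by
      intro i hi hiK
      rw [hhash]
      have hlt : n < u := by
        by_contra hge
        have hKu : K = Finset.univ := by
          rw [← Finset.card_eq_iff_eq_univ, hK, Fintype.card_fin]
          omega
        exact hiK (Finset.mem_map.2 ⟨⟨i, hi⟩, by simp [hKu], rfl⟩)
      have h1 : hashNat p a (n * q) i < n * q := Nat.mod_lt _ (by positivity)
      have h2 := Nat.div_lt_of_lt_mul (h1.trans_eq (mul_comm _ _))
      omega)
  refine ⟨D, K, hD, hK, hKz, fun i => ?_⟩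
  obtain ⟨h1, h2⟩ := hDi i i.isLt
  refine ⟨h1, ?_⟩
  rw [h2]
  have hmem : ((i : ℕ) ∈ K.map Fin.valEmbedding) ↔ i ∈ K := by
    simp [Finset.mem_map, Fin.exists_iff]
  by_cases hiK : i ∈ K
  · rw [if_pos (hmem.2 hiK), if_pos hiK, dif_pos i.isLt]
  · rw [if_neg (fun h => hiK (hmem.1 h)), if_neg hiK, hhash, ← hh]
    have h3 := hWv (h i / q) (h i % q) (Nat.mod_lt _ hq)
    rw [← pow_mul, mul_comm b] at h3
    rw [h3]
    have h4 : (h i : ℕ) / q * q + h i % q = h i := Nat.div_add_mod' _ _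
    rw [dif_pos (h4.symm ▸ (h i).isLt)]
    congr 3
    exact Fin.ext h4

/-- An element outside of the dictionary has a small multiplicity or a large noise. -/
theorem exists_count_le_of_notMem_top {n u : ℕ} {S : Multiset (Fin u)} (hS : S.card ≤ n)
    {z : Fin u → ℕ} {K : Finset (Fin u)} (hK : K.card = min n u)
    (hKz : ∀ i ∈ K, ∀ j ∉ K, z j ≤ z i) {i : Fin u} (hi : i ∉ K) :
    ∃ j, (S.count i : ℝ) ≤ |(z i : ℝ) - S.count i| + |(z j : ℝ) - S.count j| := by
  by_cases h0 : S.count i = 0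
  · exact ⟨i, by rw [h0, Nat.cast_zero]; positivity⟩
  have hlt : K.card < u := by
    have := Finset.card_lt_univ_of_notMem hi
    rwa [Fintype.card_fin] at this
  have hKn : K.card = n := by omega
  obtain ⟨j, hjK, hj⟩ : ∃ j ∈ K, S.count j = 0 := by
    by_contra! hcon
    have hsub : insert i K ⊆ S.toFinset := by
      intro j hj
      rw [Multiset.mem_toFinset, ← Multiset.count_ne_zero]
      rcases Finset.mem_insert.1 hj with rfl | hj
      · exact h0
      · exact hcon j hj
    have h1 := Finset.card_le_card hsub
    rw [Finset.card_insert_of_notMem hi] at h1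
    have h2 := Multiset.toFinset_card_le S
    omega
  refine ⟨j, ?_⟩
  have h1 : (z i : ℝ) ≤ z j := by exact_mod_cast hKz j hjK i hi
  rw [hj]
  have h2 := neg_abs_le ((z i : ℝ) - S.count i)
  have h3 := le_abs_self ((z j : ℝ) - (0 : ℕ))
  push_cast at h3 ⊢
  linarith

theorem mul_exp_neg_le {x r L : ℝ} (hx : L / r ≤ x) (hr : 0 < r) :
    x * Real.exp (-(2 * r * x)) ≤ 1 / r * Real.exp (-L) := by
  have h1 : r * x * Real.exp (-(r * x)) ≤ 1 := by
    have := Real.add_one_le_exp (r * x)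
    rw [Real.exp_neg, ← div_eq_mul_inv, div_le_one (Real.exp_pos _)]
    linarith
  have h2 : Real.exp (-(r * x)) ≤ Real.exp (-L) := by
    rw [div_le_iff₀ hr] at hx
    exact Real.exp_le_exp.2 (by linarith)
  calc x * Real.exp (-(2 * r * x)) =
        1 / r * (r * x * Real.exp (-(r * x))) * Real.exp (-(r * x)) := by
        rw [show -(2 * r * x) = -(r * x) + -(r * x) by ring, Real.exp_add]
        field_simp
    _ ≤ 1 / r * 1 * Real.exp (-L) := by gcongr
    _ = _ := by ring

/-- The multiplicities of the other elements with the same hash value. -/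
def collisionWeight {ι κ : Type*} [DecidableEq ι] [DecidableEq κ] (S : Multiset ι) (h : ι → κ)
    (i : ι) : ℕ :=
  S.countP fun j => j ≠ i ∧ h j = h i

theorem count_map_eq_add_collisionWeight {ι κ : Type*} [DecidableEq ι] [DecidableEq κ]
    (S : Multiset ι) (h : ι → κ) (i : ι) :
    (S.map h).count (h i) = S.count i + collisionWeight S h i := by
  rw [collisionWeight]
  induction S using Multiset.induction_on with
  | empty => simp
  | cons j S ih =>
    rw [Multiset.map_cons, Multiset.count_cons, Multiset.count_cons, Multiset.countP_cons, ih]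
    by_cases hji : j = i
    · subst hji
      simp
      ring
    · by_cases hh : h j = h i
      · simp [hji, hh, Ne.symm hji]
        ring
      · simp [hji, hh, Ne.symm hji, Ne.symm hh]

/-- The error of the answer, bounded by the noise of the dictionary, the noise of the bucket, the
collisions in the bucket, and a term for large multiplicities that are not in the dictionary. -/
theorem abs_answer_sub_le {n u s T : ℕ} {ε : ℝ} (hε : 0 < ε) (hu : 3 ≤ u)
    (hT : T = if n < u then min n ⌊64 * Real.log u / ε⌋₊ else 0) {S : Multiset (Fin u)}
    (hS : S.card ≤ n) {h : Fin u → Fin s} {z : Fin u → ℕ} {v : Fin s → ℕ}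
    {K : Finset (Fin u)} (hK : K.card = min n u) (hKz : ∀ i ∈ K, ∀ j ∉ K, z j ≤ z i) (i : Fin u) :
    |((if i ∈ K then z i else min T (v (h i)) : ℕ) : ℝ) - S.count i| ≤
      |(z i : ℝ) - S.count i| + |(v (h i) : ℝ) - (S.map h).count (h i)| +
      (if T = 0 then 0 else (collisionWeight S h i : ℝ)) +
      ∑ j, 64 / ε * (1 / u) * Real.exp (ε / 16 * |(z j : ℝ) - S.count j|) := by
  have hu0 : (0 : ℝ) < u := by positivity
  have hsum : ∀ j ∈ Finset.univ, 0 ≤ 64 / ε * (1 / (u : ℝ)) *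
      Real.exp (ε / 16 * |(z j : ℝ) - S.count j|) := fun _ _ => by positivity
  have hsum0 := Finset.sum_nonneg hsum
  have hcw : (0 : ℝ) ≤ if T = 0 then 0 else (collisionWeight S h i : ℝ) := by
    split_ifs <;> positivity
  have hN := abs_nonneg ((z i : ℝ) - S.count i)
  have hV := abs_nonneg ((v (h i) : ℝ) - (S.map h).count (h i))
  by_cases hi : i ∈ K
  · rw [if_pos hi]
    linarith
  rw [if_neg hi]
  have hnu : n < u := by
    have := Finset.card_lt_univ_of_notMem hi
    rw [Fintype.card_fin] at this
    omega
  rw [if_pos hnu] at hT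
  have hxn : S.count i ≤ n := (Multiset.count_le_card i S).trans hS
  have hL : 0 ≤ 64 * Real.log u / ε :=
    div_nonneg (mul_nonneg (by norm_num) (Real.log_natCast_nonneg u)) hε.le
  by_cases hxT : S.count i ≤ T
  · have hle : |((min T (v (h i)) : ℕ) : ℝ) - S.count i| ≤ |(v (h i) : ℝ) - S.count i| := by
      rw [Nat.cast_min]
      have h1 : (S.count i : ℝ) ≤ T := by exact_mod_cast hxT
      rcases le_total (T : ℝ) (v (h i)) with h2 | h2
      · rw [min_eq_left h2, abs_of_nonneg (by linarith), abs_of_nonneg (by linarith)]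
        linarith
      · rw [min_eq_right h2]
    by_cases hT0 : T = 0
    · have hx0 : S.count i = 0 := by omega
      have : |((min T (v (h i)) : ℕ) : ℝ) - S.count i| = 0 := by
        rw [hT0, hx0]
        simp
      linarith
    · rw [if_neg hT0]
      have h3 := count_map_eq_add_collisionWeight S h i
      have h4 : |(v (h i) : ℝ) - S.count i| ≤ |(v (h i) : ℝ) - (S.map h).count (h i)| +
          collisionWeight S h i := by
        have h5 := abs_sub_le (v (h i) : ℝ) ((S.map h).count (h i)) (S.count i)
        have h6 : |((S.map h).count (h i) : ℝ) - S.count i| = collisionWeight S h i := by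
          rw [h3, Nat.cast_add, add_sub_cancel_left, Nat.abs_cast]
        rwa [h6] at h5
      linarith
  · push Not at hxT
    have hx : 64 * Real.log u / ε < S.count i := by
      have h1 : ⌊64 * Real.log u / ε⌋₊ < S.count i := by omega
      exact (Nat.floor_lt hL).1 h1
    have habs : |((min T (v (h i)) : ℕ) : ℝ) - S.count i| ≤ S.count i := by
      have h1 : min T (v (h i)) ≤ S.count i := (min_le_left _ _).trans hxT.le
      have h2 : ((min T (v (h i)) : ℕ) : ℝ) ≤ S.count i := by exact_mod_cast h1
      rw [abs_of_nonpos (by linarith)]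
      have : (0 : ℝ) ≤ ((min T (v (h i)) : ℕ) : ℝ) := Nat.cast_nonneg _
      linarith
    obtain ⟨j, hj⟩ : ∃ j, (S.count i : ℝ) / 2 ≤ |(z j : ℝ) - S.count j| := by
      obtain ⟨j, hj⟩ := exists_count_le_of_notMem_top hS hK hKz hi
      by_contra! hcon
      linarith [hcon i, hcon j]
    have hterm : (S.count i : ℝ) ≤ 64 / ε * (1 / u) *
        Real.exp (ε / 16 * |(z j : ℝ) - S.count j|) := by
      have h1 := mul_exp_neg_le (x := S.count i) (r := ε / 64) (L := Real.log u)
        (by rw [div_div_eq_mul_div, mul_comm]; exact hx.le) (by positivity)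
      rw [Real.exp_neg (Real.log u), Real.exp_log hu0] at h1
      calc (S.count i : ℝ) = S.count i * Real.exp (-(2 * (ε / 64) * S.count i)) *
            Real.exp (2 * (ε / 64) * S.count i) := by
            rw [mul_assoc, ← Real.exp_add]
            simp
        _ ≤ (1 / (ε / 64) * (u : ℝ)⁻¹) * Real.exp (ε / 16 * |(z j : ℝ) - S.count j|) := by
            refine mul_le_mul h1 (Real.exp_le_exp.2 ?_) (Real.exp_pos _).le (by positivity)
            nlinarith
        _ = _ := by
            congr 1
            rw [one_div_div, inv_eq_one_div]
    have := Finset.single_le_sum hsum (Finset.mem_univ j)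
    linarith

/-- A uniformly random multiplier. -/
noncomputable def randomMultiplier {p : ℕ} (hp : p.Prime) : PMF ℕ :=
  PMF.uniformOfFinset (Finset.Icc 1 (p - 1)) <| by
    rw [Finset.nonempty_Icc]
    have := hp.two_le
    omega

theorem expectation_collision_le {p s u : ℕ} (hp : p.Prime) (hup : u ≤ p) (hs : 0 < s)
    (h : ℕ → Fin u → Fin s) (hh : ∀ a i, (h a i : ℕ) = hashNat p a s i) (i j : Fin u)
    (hij : j ≠ i) :
    ((randomMultiplier hp).expectation fun a => if h a j = h a i then 1 else 0) ≤
      ENNReal.ofReal (2 / s) := by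
  have hp1 : 0 < p - 1 := by have := hp.two_le; omega
  have hne : (Finset.Icc 1 (p - 1)).Nonempty := Finset.nonempty_Icc.2 hp1
  have hc := card_collision_mul_le (s := s) hp (j.isLt.trans_le hup) (i.isLt.trans_le hup)
    (fun h => hij (Fin.ext h))
  set F := (Finset.Icc 1 (p - 1)).filter fun a => hashNat p a s j = hashNat p a s i with hF
  have h1 : ((randomMultiplier hp).expectation fun a => if h a j = h a i then 1 else 0) =
      ∑ a ∈ F, ((p - 1 : ℕ) : ℝ≥0∞)⁻¹ := by
    rw [PMF.expectation, tsum_eq_sum (s := F)]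
    · refine Finset.sum_congr rfl fun a ha => ?_
      obtain ⟨h1, h2⟩ := Finset.mem_filter.1 ha
      have h3 : h a j = h a i := Fin.ext (by rw [hh, hh, h2])
      rw [randomMultiplier, PMF.uniformOfFinset_apply_of_mem _ h1, if_pos h3]
      simp
    · intro a ha
      rw [randomMultiplier, PMF.uniformOfFinset_apply]
      by_cases h1 : a ∈ Finset.Icc 1 (p - 1)
      · have h3 : h a j ≠ h a i := fun h3 =>
          ha (Finset.mem_filter.2 ⟨h1, by rw [← hh, ← hh, h3]⟩)
        simp [h3]
      · rw [if_neg h1, zero_mul]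
  rw [h1, Finset.sum_const, nsmul_eq_mul, ← ENNReal.ofReal_natCast (p - 1),
    ← ENNReal.ofReal_inv_of_pos (by exact_mod_cast hp1), ← ENNReal.ofReal_natCast,
    ← ENNReal.ofReal_mul (by positivity)]
  refine ENNReal.ofReal_le_ofReal ?_
  rw [← div_eq_mul_inv, div_le_div_iff₀ (by exact_mod_cast hp1) (by exact_mod_cast hs)]
  exact_mod_cast hc

theorem expectation_collisionWeight_le {p s u : ℕ} (hp : p.Prime) (hup : u ≤ p) (hs : 0 < s)
    (h : ℕ → Fin u → Fin s) (hh : ∀ a i, (h a i : ℕ) = hashNat p a s i) (S : Multiset (Fin u))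
    (i : Fin u) :
    ((randomMultiplier hp).expectation fun a => (collisionWeight S (h a) i : ℝ≥0∞)) ≤
      S.card * ENNReal.ofReal (2 / s) := by
  induction S using Multiset.induction_on with
  | empty => simp [collisionWeight, PMF.expectation]
  | cons j S ih =>
    have h1 : ∀ a, (collisionWeight (j ::ₘ S) (h a) i : ℝ≥0∞) = collisionWeight S (h a) i +
        if j ≠ i ∧ h a j = h a i then 1 else 0 := by
      intro a
      rw [collisionWeight, Multiset.countP_cons, collisionWeight]
      push_cast
      rfl
    simp only [h1]
    rw [PMF.expectation_add, Multiset.card_cons, Nat.cast_succ, add_mul, one_mul]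
    refine add_le_add ih ?_
    by_cases hij : j = i
    · simp [hij, PMF.expectation]
    · simp only [ne_eq, hij, not_false_eq_true, true_and]
      exact expectation_collision_le hp hup hs h hh i j hij

theorem log_natCast_le_of_le_two_pow {u k : ℕ} (hu : 1 ≤ u) (h : u ≤ 2 ^ k) :
    Real.log u ≤ k := by
  have h1 : Real.log u ≤ Real.log ((2 : ℝ) ^ k) :=
    Real.log_le_log (by exact_mod_cast hu) (by exact_mod_cast h)
  rw [Real.log_pow] at h1
  have h2 : Real.log 2 ≤ 1 := by linarith [Real.log_two_lt_d9]
  have h3 : (0 : ℝ) ≤ k := Nat.cast_nonneg k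
  nlinarith

/-- With `b` bits per bucket and `q` buckets per word there are few collisions. -/
theorem two_div_bucketsPerWord_le {u T w₀ q : ℕ} {ε : ℝ} (hε : 0 < ε) (hu : 3 ≤ u)
    (hw₀ : u ≤ 2 ^ w₀) (hT0 : T ≠ 0) (hT : (T : ℝ) ≤ 64 * Real.log u / ε)
    (hb : Nat.size T ≤ w₀) (hq : q = w₀ / max 1 (Nat.size T)) :
    (2 : ℝ) / q ≤ 256 / ε := by
  have hbT : max 1 (Nat.size T) ≤ T :=
    max_le (Nat.pos_of_ne_zero hT0) (Nat.size_le.2 Nat.lt_two_pow_self)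
  set b := max 1 (Nat.size T) with hbdef
  have hb1 : 1 ≤ b := le_max_left _ _
  have hw1 : 1 ≤ w₀ := by
    rcases Nat.eq_zero_or_pos w₀ with rfl | h
    · simp at hw₀
      omega
    · exact h
  have hbw : b ≤ w₀ := max_le hw1 hb
  have hq1 : 1 ≤ q := hq ▸ (Nat.one_le_div_iff hb1).2 hbw
  have h1 : w₀ ≤ 2 * q * b := by
    have h2 := Nat.lt_mul_div_succ w₀ hb1
    rw [← hq] at h2
    nlinarith
  have hlog := log_natCast_le_of_le_two_pow (by omega) hw₀
  have hq0 : (0 : ℝ) < q := by exact_mod_cast hq1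
  have hw0 : (0 : ℝ) < w₀ := by exact_mod_cast hw1
  have h3 : (w₀ : ℝ) ≤ 2 * q * b := by exact_mod_cast h1
  have h4 : (b : ℝ) ≤ T := by exact_mod_cast hbT
  have h5 : (w₀ : ℝ) ≤ 2 * q * (64 * w₀ / ε) := by
    have h6 : (b : ℝ) ≤ 64 * w₀ / ε := h4.trans (hT.trans (by gcongr))
    exact h3.trans (by gcongr)
  have h7 : 1 ≤ q * (128 / ε) := by
    have h8 : w₀ * 1 ≤ w₀ * (q * (128 / ε)) := by
      calc (w₀ : ℝ) * 1 ≤ 2 * q * (64 * w₀ / ε) := by linarith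
        _ = _ := by ring
    exact le_of_mul_le_mul_left h8 hw0
  rw [div_le_iff₀ hq0]
  calc (2 : ℝ) ≤ 2 * (q * (128 / ε)) := by linarith
    _ = _ := by ring

theorem card_mul_rpow_le {u : ℕ} (hu : 3 ≤ u) (γ : ℝ) :
    (u : ℝ) * (Real.exp (-((3 + γ) * Real.log u)) * 4) ≤ (u : ℝ) ^ (-γ) := by
  have hu3 : (3 : ℝ) ≤ u := by exact_mod_cast hu
  have hu0 : (0 : ℝ) < u := by linarith
  have h1 : Real.exp (-((3 + γ) * Real.log u)) = (u : ℝ) ^ (-γ) * ((u : ℝ) ^ 3)⁻¹ := by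
    rw [← Real.rpow_natCast, ← Real.rpow_neg hu0.le, ← Real.rpow_add hu0,
      Real.rpow_def_of_pos hu0]
    congr 1
    push_cast
    ring
  have h2 : 0 < (u : ℝ) ^ (-γ) := Real.rpow_pos_of_pos hu0 _
  rw [h1]
  calc _ = (u : ℝ) ^ (-γ) * (4 / (u : ℝ) ^ 2) := by
        field_simp
    _ ≤ (u : ℝ) ^ (-γ) * 1 := by
        gcongr
        rw [div_le_one (by positivity)]
        nlinarith
    _ = _ := mul_one _

theorem exists_private_mechanism {ε : ℝ} {n u : ℕ} (hε : 0 < ε) (hn : 1 ≤ n) (hu : 3 ≤ u) :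
    ∃ M : Multiset (Fin u) → PMF (List (BitVec (wordLength 8 n u))),
      DifferentiallyPrivate n ε M ∧
      ∀ S : Multiset (Fin u), S.card ≤ n →
        (∀ D ∈ (M S).support, D.length = 64 * min n u ∧
          ∀ i : Fin u, WordRAM.accessTime WordRAM.lookupProgram D i ≤ 52) ∧
        (∀ i : Fin u, (M S).expectation (fun D =>
          ENNReal.ofReal (estimationError WordRAM.lookupProgram S D i)) ≤
            ENNReal.ofReal (640 / ε)) ∧
        ∀ γ : ℝ, 0 < γ → (M S).toOuterMeasure {D | ∃ i : Fin u, 32 * (3 + γ) * (Real.log u / ε) <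
          estimationError WordRAM.lookupProgram S D i} ≤ ENNReal.ofReal ((u : ℝ) ^ (-γ)) := by
  set w₀ := Nat.clog 2 (u + n) with hw₀def
  have hw₀ : u + n ≤ 2 ^ w₀ := Nat.le_pow_clog (by norm_num) _
  have hw₀2 : 2 ≤ w₀ := by
    by_contra hlt
    have : 2 ^ w₀ ≤ 2 ^ 1 := Nat.pow_le_pow_right (by norm_num) (by omega)
    omega
  obtain ⟨p, hp, hup, hpu⟩ := Nat.exists_prime_lt_and_le_two_mul u (by omega)
  set T : ℕ := if n < u then min n ⌊64 * Real.log u / ε⌋₊ else 0 with hT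
  have hTn : T ≤ n := by
    rw [hT]
    split_ifs
    · exact min_le_left _ _
    · omega
  have hL : 0 ≤ 64 * Real.log u / ε :=
    div_nonneg (mul_nonneg (by norm_num) (Real.log_natCast_nonneg u)) hε.le
  have hTL : (T : ℝ) ≤ 64 * Real.log u / ε := by
    rw [hT]
    split_ifs
    · exact (Nat.cast_le.2 (min_le_right _ _)).trans (Nat.floor_le hL)
    · simpa using hL
  have hsize : Nat.size T ≤ w₀ := Nat.size_le.2 (by omega)
  set b := max 1 (Nat.size T) with hb
  have hb1 : 1 ≤ b := le_max_left _ _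
  have hbw : b ≤ w₀ := max_le (by omega) hsize
  set q := w₀ / b with hq
  have hq1 : 1 ≤ q := (Nat.one_le_div_iff hb1).2 hbw
  have hTb : T < 2 ^ b :=
    (Nat.lt_size_self T).trans_le (Nat.pow_le_pow_right (by norm_num) (le_max_right _ _))
  have hs : 0 < n * q := by positivity
  set h : ℕ → Fin u → Fin (n * q) := fun a i => ⟨hashNat p a (n * q) i, Nat.mod_lt _ hs⟩ with hh
  have hbuild := fun (z : Fin u → Fin (n + 1)) (a : ℕ) (v : Fin (n * q) → Fin (n + 1)) =>
    exists_lookupProgram_structure (w := wordLength 8 n u) rfl hw₀ hw₀2 (by omega) hn hp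
      hup.le hpu hbw hq1 (Nat.div_mul_le_self _ _) (Nat.div_le_self _ _) hTb (h a) a (fun _ => rfl) z v
  choose D K hD hK hKz hDi using hbuild
  have hδ : 0 < ε / 8 := by positivity
  set M : Multiset (Fin u) → PMF (List (BitVec (wordLength 8 n u))) := fun S =>
    (noisyCounts n (ε / 8) S).bind fun z => (randomMultiplier hp).bind fun a =>
      (noisyCounts n (ε / 8) (S.map (h a))).bind fun v => PMF.pure (D z a v) with hM
  have hE : ∀ S (f : List (BitVec (wordLength 8 n u)) → ℝ≥0∞), (M S).expectation f =
      (noisyCounts n (ε / 8) S).expectation fun z => (randomMultiplier hp).expectation fun a =>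
        (noisyCounts n (ε / 8) (S.map (h a))).expectation fun v => f (D z a v) := by
    intro S f
    simp only [hM, PMF.expectation_bind, PMF.expectation_pure]
  refine ⟨M, ?_, fun S hS => ⟨?_, ?_, ?_⟩⟩
  · intro S S' _ _ hSS' A
    refine PMF.toOuterMeasure_le_of_apply_le (fun d => ?_) A
    set c := ENNReal.ofReal (Real.exp (4 * (ε / 8))) with hc
    have hcc : ENNReal.ofReal (Real.exp ε) = c * (1 * (c * 1)) := by
      rw [mul_one, one_mul, hc, ← ENNReal.ofReal_mul (Real.exp_pos _).le, ← Real.exp_add]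
      ring_nf
    rw [hcc]
    refine PMF.bind_apply_le (noisyCounts_apply_le n hδ.le hSS') (fun z d => ?_) d
    refine PMF.bind_apply_le (fun a => (one_mul _).ge) (fun a d => ?_) d
    exact PMF.bind_apply_le (noisyCounts_apply_le n hδ.le (hSS'.map (h a)))
      (fun v d => (one_mul _).ge) d
  · intro d hd
    simp only [hM, PMF.mem_support_bind_iff, PMF.mem_support_pure_iff] at hd
    obtain ⟨z, -, a, -, v, -, rfl⟩ := hd
    exact ⟨hD z a v, fun i => (hDi z a v i).1⟩
  · intro i
    rw [hE]
    set G : ℝ≥0∞ := ENNReal.ofReal (64 / ε * (1 / u)) with hG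
    have hpoint : ∀ z a v, ENNReal.ofReal (estimationError WordRAM.lookupProgram S (D z a v) i) ≤
        ENNReal.ofReal |((z i : ℕ) : ℝ) - S.count i| +
        ENNReal.ofReal |((v (h a i) : ℕ) : ℝ) - (S.map (h a)).count (h a i)| +
        (if T = 0 then 0 else (collisionWeight S (h a) i : ℝ≥0∞)) +
        ∑ j, G * ENNReal.ofReal (Real.exp (ε / 8 / 2 * |((z j : ℕ) : ℝ) - S.count j|)) := by
      intro z a v
      rw [estimationError, (hDi z a v i).2]
      refine (ENNReal.ofReal_le_ofReal (abs_answer_sub_le hε hu hT hS (h := h a)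
        (z := fun i => z i) (v := fun b => v b) (hK z a v) (hKz z a v) i)).trans ?_
      have hcw : (0 : ℝ) ≤ if T = 0 then 0 else (collisionWeight S (h a) i : ℝ) := by
        split_ifs <;> positivity
      rw [ENNReal.ofReal_add (by positivity) (Finset.sum_nonneg fun _ _ => by positivity),
        ENNReal.ofReal_add (by positivity) hcw, ENNReal.ofReal_add (by positivity) (by positivity),
        ENNReal.ofReal_sum_of_nonneg fun _ _ => by positivity]
      refine add_le_add (add_le_add le_rfl ?_) (Finset.sum_le_sum fun j _ => ?_)
      · split_ifs
        · simp
        · simp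
      · rw [hG, ← ENNReal.ofReal_mul (by positivity), div_div]
        norm_num
    have hv : ∀ z a, ((noisyCounts n (ε / 8) (S.map (h a))).expectation fun v =>
        ENNReal.ofReal (estimationError WordRAM.lookupProgram S (D z a v) i)) ≤
        ENNReal.ofReal |((z i : ℕ) : ℝ) - S.count i| + ENNReal.ofReal (64 / ε) +
        (if T = 0 then 0 else (collisionWeight S (h a) i : ℝ≥0∞)) +
        ∑ j, G * ENNReal.ofReal (Real.exp (ε / 8 / 2 * |((z j : ℕ) : ℝ) - S.count j|)) := by
      intro z a
      refine (PMF.expectation_mono _ (hpoint z a)).trans ?_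
      rw [PMF.expectation_add, PMF.expectation_add, PMF.expectation_add, PMF.expectation_const,
        PMF.expectation_const, PMF.expectation_const]
      gcongr
      refine (expectation_abs_noisyCounts_le n hδ (by simpa using hS) (h a i)).trans_eq ?_
      congr 1
      field_simp
      norm_num
    have hcoll : ((randomMultiplier hp).expectation fun a =>
        if T = 0 then 0 else (collisionWeight S (h a) i : ℝ≥0∞)) ≤ ENNReal.ofReal (256 / ε) := by
      by_cases hT0 : T = 0
      · simp [hT0, PMF.expectation]
      · simp only [if_neg hT0]
        refine (expectation_collisionWeight_le hp hup.le hs h (fun _ _ => rfl) S i).trans ?_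
        rw [← ENNReal.ofReal_natCast, ← ENNReal.ofReal_mul (by positivity)]
        refine ENNReal.ofReal_le_ofReal ?_
        refine le_trans ?_ (two_div_bucketsPerWord_le hε hu (by omega : u ≤ 2 ^ w₀) hT0 hTL hsize hq)
        have hn0 : (0 : ℝ) < n := by exact_mod_cast hn
        have hq0 : (0 : ℝ) < q := by exact_mod_cast hq1
        have hSn : (S.card : ℝ) ≤ n := by exact_mod_cast hS
        calc (S.card : ℝ) * (2 / ((n * q : ℕ) : ℝ)) ≤ n * (2 / ((n * q : ℕ) : ℝ)) := by gcongr
          _ = 2 / q := by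
            push_cast
            field_simp
    have ha : ∀ z, ((randomMultiplier hp).expectation fun a =>
        (noisyCounts n (ε / 8) (S.map (h a))).expectation fun v =>
        ENNReal.ofReal (estimationError WordRAM.lookupProgram S (D z a v) i)) ≤
        ENNReal.ofReal |((z i : ℕ) : ℝ) - S.count i| + ENNReal.ofReal (64 / ε) +
        ENNReal.ofReal (256 / ε) +
        ∑ j, G * ENNReal.ofReal (Real.exp (ε / 8 / 2 * |((z j : ℕ) : ℝ) - S.count j|)) := by
      intro z
      refine (PMF.expectation_mono _ (hv z)).trans ?_
      rw [PMF.expectation_add, PMF.expectation_add, PMF.expectation_add, PMF.expectation_const,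
        PMF.expectation_const, PMF.expectation_const]
      gcongr
    refine (PMF.expectation_mono _ ha).trans ?_
    rw [PMF.expectation_add, PMF.expectation_add, PMF.expectation_add, PMF.expectation_const,
      PMF.expectation_const, PMF.expectation_finset_sum]
    have h1 : ((noisyCounts n (ε / 8) S).expectation fun z =>
        ENNReal.ofReal |((z i : ℕ) : ℝ) - S.count i|) ≤ ENNReal.ofReal (64 / ε) := by
      refine (expectation_abs_noisyCounts_le n hδ hS i).trans_eq ?_
      congr 1
      field_simp
      norm_num
    have h2 : (∑ j, (noisyCounts n (ε / 8) S).expectation fun z => G *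
        ENNReal.ofReal (Real.exp (ε / 8 / 2 * |((z j : ℕ) : ℝ) - S.count j|))) ≤
        ENNReal.ofReal (256 / ε) := by
      calc _ ≤ ∑ j : Fin u, G * 4 := by
            refine Finset.sum_le_sum fun j _ => ?_
            rw [PMF.expectation_const_mul]
            gcongr
            exact expectation_exp_noisyCounts_le n hδ.le hS j
        _ = _ := by
            rw [Finset.sum_const, Finset.card_univ, Fintype.card_fin, nsmul_eq_mul, hG,
              ← ENNReal.ofReal_natCast u, show (4 : ℝ≥0∞) = ENNReal.ofReal 4 by simp,
              ← ENNReal.ofReal_mul (by positivity), ← ENNReal.ofReal_mul (by positivity)]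
            congr 1
            have : (u : ℝ) ≠ 0 := by positivity
            field_simp
            norm_num
    refine (add_le_add (add_le_add (add_le_add h1 le_rfl) le_rfl) h2).trans_eq ?_
    rw [← ENNReal.ofReal_add (by positivity) (by positivity),
      ← ENNReal.ofReal_add (by positivity) (by positivity),
      ← ENNReal.ofReal_add (by positivity) (by positivity)]
    congr 1
    ring
  · intro γ hγ
    set A := {d : List (BitVec (wordLength 8 n u)) | ∃ i : Fin u,
      32 * (3 + γ) * (Real.log u / ε) < estimationError WordRAM.lookupProgram S d i} with hA
    refine (PMF.toOuterMeasure_le_expectation (M S) (f := A.indicator 1)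
      fun d hd => by rw [Set.indicator_of_mem hd]; rfl).trans ?_
    rw [hE]
    set t := 16 * (3 + γ) * (Real.log u / ε) with ht
    have hlog : 0 ≤ Real.log u / ε := div_nonneg (Real.log_natCast_nonneg u) hε.le
    have hpoint : ∀ z a v, A.indicator (1 : List (BitVec (wordLength 8 n u)) → ℝ≥0∞) (D z a v) ≤
        ∑ j, ENNReal.ofReal (Real.exp (-((3 + γ) * Real.log u))) *
          ENNReal.ofReal (Real.exp (ε / 8 / 2 * |((z j : ℕ) : ℝ) - S.count j|)) := by
      intro z a v
      by_cases hd : D z a v ∈ A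
      · rw [Set.indicator_of_mem hd]
        obtain ⟨i, hi⟩ := hd
        rw [estimationError, (hDi z a v i).2] at hi
        obtain ⟨j, hj⟩ : ∃ j, t < |((z j : ℕ) : ℝ) - S.count j| := by
          by_contra! hcon
          have ht0 : 0 ≤ t := (abs_nonneg _).trans (hcon i)
          refine absurd hi (not_lt.2 ?_)
          rw [show 32 * (3 + γ) * (Real.log u / ε) = 2 * t by rw [ht]; ring]
          split_ifs with hiK
          · linarith [hcon i]
          · obtain ⟨j, hj⟩ := exists_count_le_of_notMem_top hS (z := fun i => z i) (hK z a v)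
              (hKz z a v) hiK
            have h1 : (S.count i : ℝ) ≤ 2 * t := by
              have := hcon i
              have := hcon j
              linarith
            have h2 : ((min T (v (h a i)) : ℕ) : ℝ) ≤ 2 * t := by
              refine (Nat.cast_le.2 (min_le_left _ _)).trans (hTL.trans ?_)
              rw [ht, mul_div_assoc]
              nlinarith
            have h3 : (0 : ℝ) ≤ ((min T (v (h a i)) : ℕ) : ℝ) := Nat.cast_nonneg _
            have h4 : (0 : ℝ) ≤ S.count i := Nat.cast_nonneg _
            rw [abs_le]
            constructor <;> linarith
        refine le_trans ?_ (Finset.single_le_sum (fun _ _ => zero_le) (Finset.mem_univ j))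
        rw [← ENNReal.ofReal_mul (Real.exp_pos _).le, ← Real.exp_add, Pi.one_apply,
          ← ENNReal.ofReal_one]
        refine ENNReal.ofReal_le_ofReal (Real.one_le_exp ?_)
        have h5 : (3 + γ) * Real.log u = ε / 8 / 2 * t := by
          rw [ht]
          field_simp
          ring
        rw [h5]
        nlinarith
      · rw [Set.indicator_of_notMem hd]
        exact zero_le
    calc _ ≤ (noisyCounts n (ε / 8) S).expectation fun z =>
          ∑ j, ENNReal.ofReal (Real.exp (-((3 + γ) * Real.log u))) *
            ENNReal.ofReal (Real.exp (ε / 8 / 2 * |((z j : ℕ) : ℝ) - S.count j|)) := by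
          refine PMF.expectation_mono _ fun z => ?_
          refine (PMF.expectation_mono _ fun a => PMF.expectation_mono _ (hpoint z a)).trans ?_
          simp only [PMF.expectation_const]
          exact le_rfl
      _ ≤ ∑ j : Fin u, ENNReal.ofReal (Real.exp (-((3 + γ) * Real.log u))) * 4 := by
          rw [PMF.expectation_finset_sum]
          refine Finset.sum_le_sum fun j _ => ?_
          rw [PMF.expectation_const_mul]
          gcongr
          exact expectation_exp_noisyCounts_le n hδ.le hS j
      _ ≤ _ := by
          rw [Finset.sum_const, Finset.card_univ, Fintype.card_fin, nsmul_eq_mul,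
            ← ENNReal.ofReal_natCast u, show (4 : ℝ≥0∞) = ENNReal.ofReal 4 by simp,
            ← ENNReal.ofReal_mul (by positivity), ← ENNReal.ofReal_mul (by positivity)]
          exact ENNReal.ofReal_le_ofReal (card_mul_rpow_le hu γ)

theorem one_lt_log_natCast {u : ℕ} (hu : 3 ≤ u) : 1 < Real.log u := by
  have h3 : (3 : ℝ) ≤ u := by exact_mod_cast hu
  rw [Real.lt_log_iff_exp_lt (by linarith)]
  linarith [Real.exp_one_lt_d9]

theorem clog_mul_min_le {n u : ℕ} (hn : 1 ≤ n) (hu : 3 ≤ u) :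
    (Nat.clog 2 (u + n) : ℝ) * min n u ≤ 5 * (n * Real.log u) := by
  have hlog := one_lt_log_natCast hu
  have hn1 : (1 : ℝ) ≤ n := by exact_mod_cast hn
  have hu3 : (3 : ℝ) ≤ u := by exact_mod_cast hu
  have hclog : (Nat.clog 2 (u + n) : ℝ) ≤ 1 + 2 * Real.log (u + n) := by
    have h1 : 2 ^ (Nat.clog 2 (u + n)).pred < u + n :=
      Nat.pow_pred_clog_lt_self (by norm_num) (by omega)
    have h2 : ((Nat.clog 2 (u + n)).pred : ℝ) * Real.log 2 ≤ Real.log (u + n) := by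
      rw [← Real.log_pow]
      exact Real.log_le_log (by positivity) (by exact_mod_cast h1.le)
    have h3 : (Nat.clog 2 (u + n) : ℝ) ≤ (Nat.clog 2 (u + n)).pred + 1 := by
      exact_mod_cast Nat.le_succ_of_pred_le le_rfl
    have h4 := Real.log_two_gt_d9
    have h5 : (0 : ℝ) ≤ ((Nat.clog 2 (u + n)).pred : ℝ) := Nat.cast_nonneg _
    nlinarith
  have hlog2 : Real.log 2 ≤ 1 := by linarith [Real.log_two_lt_d9]
  have key : Real.log (u + n) * min (n : ℝ) u ≤ 2 * (n * Real.log u) := by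
    rcases le_total (n : ℝ) u with h | h
    · rw [min_eq_left h]
      have h1 : Real.log (u + n) ≤ Real.log 2 + Real.log u := by
        rw [← Real.log_mul (by norm_num) (by linarith)]
        exact Real.log_le_log (by linarith) (by linarith)
      nlinarith
    · rw [min_eq_right h]
      have h1 : Real.log (u + n) ≤ Real.log 2 + Real.log n := by
        rw [← Real.log_mul (by norm_num) (by linarith)]
        exact Real.log_le_log (by linarith) (by linarith)
      have he : Real.exp 1 ≤ u := by linarith [Real.exp_one_lt_d9]
      have h2 := Real.log_div_self_antitoneOn he (he.trans h) h
      rw [div_le_div_iff₀ (by linarith) (by linarith)] at h2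
      nlinarith
  have hmin : min (n : ℝ) u ≤ n * Real.log u := (min_le_left _ _).trans (by nlinarith)
  have hmin0 : 0 ≤ min (n : ℝ) u := le_min (by linarith) (by linarith)
  rw [Nat.cast_min]
  nlinarith [mul_le_mul_of_nonneg_right hclog hmin0]

theorem mainTheorem3 :
    ∃ (P : WordRAM.Program) (c : ℕ) (C : ℝ) (K : ℝ → ℝ), 1 ≤ c ∧
      ∀ (ε : ℝ) (n u : ℕ), 0 < ε → 3 ≤ u →
        ∃ M : Multiset (Fin u) → PMF (List (BitVec (wordLength c n u))),
          DifferentiallyPrivate n ε M ∧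
          ∀ S : Multiset (Fin u), S.card ≤ n →
            (∀ D ∈ (M S).support,
              ((wordLength c n u * D.length : ℕ) : ℝ) ≤ C * (n * Real.log u)) ∧
            (∀ i : Fin u,
              (M S).expectation (fun D => (WordRAM.accessTime P D i : ℝ≥0∞)) ≤
                ENNReal.ofReal (C * Real.log (Real.log u))) ∧
            (∀ i : Fin u,
              (M S).expectation (fun D => ENNReal.ofReal (estimationError P S D i)) ≤
                ENNReal.ofReal (C / ε)) ∧
            (∀ γ : ℝ, 0 < γ →
              (M S).toOuterMeasure
                  {D | ∃ i : Fin u, K γ * (Real.log u / ε) < estimationError P S D i} ≤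
                ENNReal.ofReal ((u : ℝ) ^ (-γ))) := by
  have hll : 0 < Real.log (Real.log 3) := Real.log_pos (by exact_mod_cast one_lt_log_natCast le_rfl)
  set C := 2560 + 52 / Real.log (Real.log 3) with hC
  have hC0 : 2560 ≤ C := by
    have := div_pos (show (0 : ℝ) < 52 by norm_num) hll
    linarith
  refine ⟨WordRAM.lookupProgram, 8, C, fun γ => 32 * (3 + γ), by norm_num, fun ε n u hε hu => ?_⟩
  have hlog := one_lt_log_natCast hu
  have haccess : (52 : ℝ≥0∞) ≤ ENNReal.ofReal (C * Real.log (Real.log u)) := by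
    rw [show (52 : ℝ≥0∞) = ENNReal.ofReal 52 by simp]
    refine ENNReal.ofReal_le_ofReal ?_
    have h1 : Real.log (Real.log 3) ≤ Real.log (Real.log u) :=
      Real.log_le_log (by exact_mod_cast zero_lt_one.trans (one_lt_log_natCast le_rfl))
        (Real.log_le_log (by norm_num) (by exact_mod_cast hu))
    calc (52 : ℝ) = 52 / Real.log (Real.log 3) * Real.log (Real.log 3) := by field_simp
      _ ≤ C * Real.log (Real.log u) := by
        gcongr
        linarith
  have htime : ∀ (p : PMF (List (BitVec (wordLength 8 n u)))) (i : Fin u),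
      (∀ D ∈ p.support, WordRAM.accessTime WordRAM.lookupProgram D i ≤ 52) →
      p.expectation (fun D => (WordRAM.accessTime WordRAM.lookupProgram D i : ℝ≥0∞)) ≤
        ENNReal.ofReal (C * Real.log (Real.log u)) := by
    intro p i h
    refine le_trans ?_ haccess
    rw [← p.expectation_const 52]
    refine ENNReal.tsum_le_tsum fun D => ?_
    by_cases hD : D ∈ p.support
    · have h1 : (WordRAM.accessTime WordRAM.lookupProgram D i : ℝ≥0∞) ≤ 52 := by
        have := ENat.toENNReal_le.2 (h D hD)
        exact_mod_cast this
      gcongr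
    · rw [(p.apply_eq_zero_iff D).2 hD, zero_mul]
      exact zero_le
  rcases Nat.eq_zero_or_pos n with rfl | hn
  · refine ⟨fun _ => PMF.pure [], ?_, fun S hS => ⟨?_, ?_, ?_, ?_⟩⟩
    · intro S T _ _ _ A
      refine le_mul_of_one_le_left' ?_
      rw [ENNReal.one_le_ofReal]
      exact Real.one_le_exp hε.le
    · simp
    · intro i
      have hw : wordLength 8 0 u ≠ 0 :=
        Nat.mul_ne_zero (by norm_num) (Nat.clog_pos (by norm_num) (by omega)).ne'
      exact htime _ i fun D _ =>
        (WordRAM.lookupProgram_spec hw D i).1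
    all_goals
      have hw : wordLength 8 0 u ≠ 0 :=
        Nat.mul_ne_zero (by norm_num) (Nat.clog_pos (by norm_num) (by omega)).ne'
      have herr : ∀ i : Fin u, estimationError WordRAM.lookupProgram S
          ([] : List (BitVec (wordLength 8 0 u))) i = 0 := by
        intro i
        have h0 : S = 0 := Multiset.card_eq_zero.1 (Nat.le_zero.1 hS)
        rw [estimationError, WordRAM.answer_lookupProgram_nil hw, h0]
        simp
    · intro i
      rw [PMF.expectation_pure, herr]
      simp
    · intro γ hγ
      rw [PMF.toOuterMeasure_pure_apply, if_neg]
      · exact zero_le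
      · rintro ⟨i, hi⟩
        rw [herr] at hi
        have : 0 ≤ 32 * (3 + γ) * (Real.log u / ε) := by positivity
        linarith
  · obtain ⟨M, hM, hMS⟩ := exists_private_mechanism hε hn hu
    refine ⟨M, hM, fun S hS => ?_⟩
    obtain ⟨h1, h2, h3⟩ := hMS S hS
    refine ⟨fun D hD => ?_, fun i => htime _ i fun D hD => (h1 D hD).2 i, fun i => ?_, h3⟩
    · rw [(h1 D hD).1, wordLength]
      have h4 := clog_mul_min_le hn hu
      have h5 : 0 ≤ (n : ℝ) * Real.log u := by positivity
      push_cast at h4 ⊢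
      nlinarith [mul_le_mul_of_nonneg_right hC0 h5]
    · exact (h2 i).trans (ENNReal.ofReal_le_ofReal (by gcongr; linarith))
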